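/- **Theorem.** For $n\in\mathbb{N}$ let $r_3(n)=\#\{a\in\mathbb{Z}^3: a_1^2+a_2^2+a_3^2=n\}$. Let $N_{3,0}(\Sigma)=\#\{v\in\mathbb{Z}^3:|v|\le\Sigma\}$ (so $N_{3,0}(\Sigma)=0$ for $\Sigma<0$) and $N_{3,k}(\Sigma)=\int_0^\Sigma N_{3,k-1}(\sigma)\,\mathrm{d}\sigma$ for $k\ge 1$. Let $\dot{\mathscr S}'(\mathbb{R}^{\ge 0})$ be the space of tempered distributions $u$ on $\mathbb{R}$ with $u(\chi)=0$ for every Schwartz function $\chi$ whose support is disjoint from $[0,\infty)$, with the topology induced by the weak-$*$ topology of $\mathscr S'(\mathbb{R})$. A measurable function $f$ on $[0,\infty)$ with $(1+\Sigma^2)^{-K}f\in L^1[0,\infty)$ for some $K$ is identified with the element $\chi\mapsto\int_0^\infty\chi(\Sigma)f(\Sigma)\,\mathrm{d}\Sigma$ of $\dot{\mathscr S}'(\mathbb{R}^{\ge 0})$. For $j\ge 0$ put $$C_j=\begin{cases}0 & (j\text{ odd}),\\ +(2j+4)(2\pi)^{-j-3}\sum_{n=1}^\infty r_3(n)n^{-2-j/2}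 & (j\equiv 0 \bmod 4),\\ -(2j+4)(2\pi)^{-j-3}\sum_{n=1}^\infty r_3(n)n^{-2-j/2} & (j\equiv 2 \bmod 4),\end{cases}$$ where the series $\sum_{n\ge1} r_3(n)n^{-2-j/2}$ converge absolutely. Then for every $k=0,1,2,\dots$ the series $$o_k(\Sigma)=-\frac1\pi\sum_{n=1}^\infty\frac{r_3(n)}{n}\frac{1}{(2\pi\sqrt n)^k}\Big[\Re[i^k]\,\Sigma\cos(2\pi\sqrt n\,\Sigma)+\Im[i^k]\,\Sigma\sin(2\pi\sqrt n\,\Sigma)+\frac{k+1}{2\pi\sqrt n}\Im[i^k]\cos(2\pi\sqrt n\,\Sigma)-\frac{k+1}{2\pi\sqrt n}\Re[i^k]\sin(2\pi\sqrt n\,\Sigma)\Big]$$ is unconditionally summable in $\dot{\mathscr S}'(\mathbb{R}^{\ge 0})$, and, as elements of $\dot{\mathscr S}'(\mathbb{R}^{\ge 0})$, $$N_{3,k}(\Sigma)=\frac{8\pi}{(3+k)!}\Sigma^{3+k}+\sum_{m=0}^{k-1}\frac{C_{k-1-m}}{m!}\Sigma^m+o_k(\Sigma).\qquad(*)$$ If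 $k\ge 2$, then moreover: the series for $o_k(\Sigma)$ converges absolutely for each $\Sigma\ge 0$, and $(*)$ holds in the ordinary sense for each $\Sigma\ge 0$; the distribution $o_k$ is given by a unique continuous function on $[0,\infty)$, namely the pointwise sum of the series, again called $o_k$; the series converges (unconditionally) uniformly to it on every compact $K\subset[0,\infty)$; and the right-hand side of $(*)$ vanishes at $\Sigma=0$, i.e. $o_k(0)=-C_{k-1}$, so that in particular $o_k(0)=0$ when $k$ is even. -/

import Mathlib

open scoped SchwartzMap

namespace GaussSphere

open MeasureTheory Set

/-! ### Lattice point counting in dimension three -/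

/-- `r3 n` is the number of `a : ℤ³` with `a₀² + a₁² + a₂² = n`. -/
noncomputable def r3 (n : ℕ) : ℕ :=
  Set.ncard {a : Fin 3 → ℤ | ∑ i, a i ^ 2 = (n : ℤ)}

/-- `N3 R` is the number of lattice points in the closed Euclidean ball of radius `R` in `ℝ³`
(so it is `0` for `R < 0`). -/
noncomputable def N3 (R : ℝ) : ℝ :=
  (Set.ncard {a : Fin 3 → ℤ |
    ‖(WithLp.toLp 2 (fun i => (a i : ℝ)) : EuclideanSpace ℝ (Fin 3))‖ ≤ R} : ℝ)

/-- The iterated integrals of `N3`. -/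
noncomputable def N3k : ℕ → ℝ → ℝ
  | 0 => N3
  | k + 1 => fun R => ∫ σ in (0 : ℝ)..R, N3k k σ

/-! ### The terms of the formula -/

/-- The constants `C_j`. -/
noncomputable def C (j : ℕ) : ℝ :=
  if j % 2 = 1 then 0
  else if j % 4 = 0 then
    (2 * (j : ℝ) + 4) * ((2 * Real.pi) ^ (j + 3))⁻¹ *
      ∑' n : ℕ+, (r3 n : ℝ) * (n : ℝ) ^ (-2 - (j : ℝ) / 2)
  else
    -((2 * (j : ℝ) + 4) * ((2 * Real.pi) ^ (j + 3))⁻¹ *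
      ∑' n : ℕ+, (r3 n : ℝ) * (n : ℝ) ^ (-2 - (j : ℝ) / 2))

/-- The non-oscillatory part. -/
noncomputable def polyPart (k : ℕ) (x : ℝ) : ℝ :=
  8 * Real.pi / ((3 + k).factorial : ℝ) * x ^ (3 + k) +
    ∑ m ∈ Finset.range k, C (k - 1 - m) / (m.factorial : ℝ) * x ^ m

/-- The `n`-th term of the oscillatory series `o_k`. -/
noncomputable def oscTerm (k : ℕ) (n : ℕ+) (x : ℝ) : ℝ :=
  -(1 / Real.pi) * ((r3 n : ℝ) / (n : ℝ)) * (1 / (2 * Real.pi * √(n : ℝ)) ^ k) *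
    ((Complex.I ^ k).re * (x * Real.cos (2 * Real.pi * √(n : ℝ) * x))
      + (Complex.I ^ k).im * (x * Real.sin (2 * Real.pi * √(n : ℝ) * x))
      + ((k : ℝ) + 1) / (2 * Real.pi * √(n : ℝ)) * (Complex.I ^ k).im *
          Real.cos (2 * Real.pi * √(n : ℝ) * x)
      - ((k : ℝ) + 1) / (2 * Real.pi * √(n : ℝ)) * (Complex.I ^ k).re *
          Real.sin (2 * Real.pi * √(n : ℝ) * x))

/-- The ordinary pointwise sum of the oscillatory series. -/
noncomputable def oscSum (k : ℕ) (x : ℝ) : ℝ := ∑' n : ℕ+, oscTerm k n x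

/-! ### Supported tempered distributions on `[0, ∞)` -/

/-- The space of tempered distributions on `ℝ` supported in `[0, ∞)`, i.e. those that vanish on
every Schwartz function whose support is disjoint from `[0, ∞)`. Its topology is the subspace
topology induced by the weak-* topology of `𝓢'(ℝ, ℂ)`. -/
noncomputable def SupportedDist : Submodule ℂ 𝓢'(ℝ, ℂ) where
  carrier := {u | ∀ χ : 𝓢(ℝ, ℂ), Disjoint (tsupport χ) (Ici (0 : ℝ)) → u χ = 0}
  add_mem' := by
    intro u v hu hv χ hχ
    simp [hu χ hχ, hv χ hχ]
  zero_mem' := by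
    intro χ _
    simp
  smul_mem' := by
    intro c u hu χ hχ
    simp [hu χ hχ]

/-- `f` restricted to `[0, ∞)` lies in `⋃_K ⟨x⟩^K L¹[0, ∞)`, where `⟨x⟩ = (1 + x²)^{1/2}`. -/
def IsTemperedFun (f : ℝ → ℝ) : Prop :=
  ∃ K : ℕ, IntegrableOn (fun x => f x / (1 + x ^ 2) ^ K) (Ici 0)

lemma norm_le_seminorm (K : ℕ) : ∃ D : ℝ, 0 ≤ D ∧ ∃ s : Finset (ℕ × ℕ),
    ∀ (χ : 𝓢(ℝ, ℂ)) (x : ℝ),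
      (1 + x ^ 2) ^ K * ‖χ x‖ ≤ D * (s.sup (schwartzSeminormFamily ℂ ℝ ℂ)) χ := by
  refine ⟨2 ^ (2 * K), by positivity, Finset.Iic (2 * K, 0), fun χ x => ?_⟩
  have h := SchwartzMap.one_add_le_sup_seminorm_apply (𝕜 := ℂ) (m := (2 * K, 0)) (k := 2 * K)
    (n := 0) le_rfl le_rfl χ x
  simp only [norm_iteratedFDeriv_zero] at h
  refine le_trans ?_ h
  gcongr
  rw [pow_mul]
  gcongr
  have : x ^ 2 = ‖x‖ ^ 2 := by simp
  nlinarith [norm_nonneg x]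

lemma mul_eq_aux (K : ℕ) (f : ℝ → ℝ) (χ : 𝓢(ℝ, ℂ)) (x : ℝ) :
    χ x * (f x : ℂ) =
      ((1 + x ^ 2 : ℝ) ^ K : ℝ) * χ x * ((f x / (1 + x ^ 2) ^ K : ℝ) : ℂ) := by
  have h : ((1 + x ^ 2 : ℝ) ^ K : ℝ) ≠ 0 := by positivity
  have h' : (((1 + x ^ 2 : ℝ) ^ K : ℝ) : ℂ) ≠ 0 := by exact_mod_cast h
  rw [Complex.ofReal_div]
  field_simp

lemma norm_mul_le (K : ℕ) (f : ℝ → ℝ) (χ : 𝓢(ℝ, ℂ)) (x : ℝ) (B : ℝ)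
    (hB : (1 + x ^ 2) ^ K * ‖χ x‖ ≤ B) :
    ‖χ x * (f x : ℂ)‖ ≤ B * ‖f x / (1 + x ^ 2) ^ K‖ := by
  rw [mul_eq_aux K, norm_mul, norm_mul, Complex.norm_real, Complex.norm_real,
    Real.norm_of_nonneg (by positivity : (0 : ℝ) ≤ (1 + x ^ 2) ^ K)]
  gcongr

lemma integrableOn_mul {f : ℝ → ℝ} (hf : IsTemperedFun f) (χ : 𝓢(ℝ, ℂ)) :
    IntegrableOn (fun x => χ x * (f x : ℂ)) (Ici 0) := by
  obtain ⟨K, hK⟩ := hf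
  obtain ⟨D, hD, s, hs⟩ := norm_le_seminorm K
  refine Integrable.mono' (hK.norm.const_mul (D * (s.sup (schwartzSeminormFamily ℂ ℝ ℂ)) χ)) ?_
    (Filter.Eventually.of_forall fun x => norm_mul_le K f χ x _ (hs χ x))
  have h1 : AEStronglyMeasurable (fun x : ℝ => ((f x / (1 + x ^ 2) ^ K : ℝ) : ℂ))
      (volume.restrict (Ici 0)) :=
    Complex.continuous_ofReal.comp_aestronglyMeasurable hK.aestronglyMeasurable
  have h2 : Continuous (fun x : ℝ => (((1 + x ^ 2 : ℝ) ^ K : ℝ) : ℂ) * χ x) := by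
    have := χ.continuous
    fun_prop
  refine (h2.aestronglyMeasurable.mul h1).congr ?_
  exact Filter.Eventually.of_forall fun x => (mul_eq_aux K f χ x).symm

/-- The supported tempered distribution `χ ↦ ∫₀^∞ χ f` (that is, `Θ f`) of a function
`f` in `⋃_K ⟨x⟩^K L¹[0, ∞)`. -/
noncomputable def ofFun (f : ℝ → ℝ) (hf : IsTemperedFun f) : SupportedDist :=
  ⟨ContinuousLinearMap.toPointwiseConvergenceCLM ℂ (RingHom.id ℂ) 𝓢(ℝ, ℂ) ℂ
    (SchwartzMap.mkCLMtoNormedSpace (σ := RingHom.id ℂ)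
      (fun χ : 𝓢(ℝ, ℂ) => ∫ x in Ici (0 : ℝ), χ x * (f x : ℂ))
      (fun χ ψ => by
        rw [← integral_add (integrableOn_mul hf χ) (integrableOn_mul hf ψ)]
        simp [add_mul])
      (fun a χ => by
        simp only [smul_apply, smul_eq_mul, mul_assoc, RingHom.id_apply]
        rw [integral_const_mul])
      (by
        obtain ⟨K, hK⟩ := hf
        obtain ⟨D, hD, s, hs⟩ := norm_le_seminorm K
        refine ⟨s, D * ∫ x in Ici (0 : ℝ), ‖f x / (1 + x ^ 2) ^ K‖, ?_, fun χ => ?_⟩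
        · exact mul_nonneg hD (integral_nonneg fun x => norm_nonneg _)
        · refine (norm_integral_le_of_norm_le
            (hK.norm.const_mul (D * (s.sup (schwartzSeminormFamily ℂ ℝ ℂ)) χ))
            (Filter.Eventually.of_forall fun x => norm_mul_le K f χ x _ (hs χ x))).trans ?_
          rw [integral_const_mul]
          apply le_of_eq
          ring)), by
    intro χ hχ
    change ∫ x in Ici (0 : ℝ), χ x * (f x : ℂ) = 0
    refine setIntegral_eq_zero_of_forall_eq_zero fun x hx => ?_
    rw [image_eq_zero_of_notMem_tsupport (fun h => Set.disjoint_left.1 hχ h hx), zero_mul]⟩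

lemma ofFun_apply (f : ℝ → ℝ) (hf : IsTemperedFun f) (χ : 𝓢(ℝ, ℂ)) :
    (ofFun f hf : 𝓢'(ℝ, ℂ)) χ = ∫ x in Ici (0 : ℝ), χ x * (f x : ℂ) := rfl

/-! ### The functions of the formula are of the required class -/

lemma isTemperedFun_of_bound {f : ℝ → ℝ} (hm : AEStronglyMeasurable f (volume.restrict (Ici 0)))
    (A : ℝ) (K : ℕ) (h : ∀ x, 0 ≤ x → |f x| ≤ A * (1 + x ^ 2) ^ K) : IsTemperedFun f := by
  refine ⟨K + 1, ?_⟩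
  refine Integrable.mono' ((integrable_inv_one_add_sq.const_mul A).integrableOn) ?_ ?_
  · have hc : Continuous fun x : ℝ => ((1 + x ^ 2) ^ (K + 1))⁻¹ :=
      Continuous.inv₀ (by fun_prop) fun x => by positivity
    simp only [div_eq_mul_inv]
    exact hm.mul hc.aestronglyMeasurable
  · refine (ae_restrict_iff' measurableSet_Ici).2 (Filter.Eventually.of_forall fun x hx => ?_)
    have hp : (0 : ℝ) < (1 + x ^ 2) ^ (K + 1) := by positivity
    rw [Real.norm_eq_abs, abs_div, abs_of_pos hp, div_le_iff₀ hp]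
    refine (h x hx).trans (le_of_eq ?_)
    have : (1 + x ^ 2 : ℝ) ≠ 0 := by positivity
    field_simp
    ring

lemma isTemperedFun_polyPart (k : ℕ) : IsTemperedFun (polyPart k) := by
  refine isTemperedFun_of_bound (Continuous.aestronglyMeasurable (by unfold polyPart; fun_prop))
    (|8 * Real.pi / ((3 + k).factorial : ℝ)| +
      ∑ m ∈ Finset.range k, |C (k - 1 - m) / (m.factorial : ℝ)|) (3 + k) fun x hx => ?_
  have hx1 : x ≤ 1 + x ^ 2 := by nlinarith [sq_nonneg (x - 1)]
  have h1 : (1 : ℝ) ≤ 1 + x ^ 2 := by nlinarith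
  have hb : ∀ m, m ≤ 3 + k → |x ^ m| ≤ (1 + x ^ 2) ^ (3 + k) := fun m hm => by
    rw [abs_of_nonneg (by positivity)]
    exact (pow_le_pow_left₀ hx hx1 m).trans (pow_le_pow_right₀ h1 hm)
  unfold polyPart
  refine (abs_add_le _ _).trans ?_
  rw [add_mul, Finset.sum_mul]
  refine add_le_add ?_ ((Finset.abs_sum_le_sum_abs _ _).trans (Finset.sum_le_sum fun m hm => ?_))
  · rw [abs_mul]
    exact mul_le_mul_of_nonneg_left (hb _ le_rfl) (abs_nonneg _)
  · rw [abs_mul]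
    refine mul_le_mul_of_nonneg_left (hb _ ?_) (abs_nonneg _)
    have := Finset.mem_range.1 hm
    omega

lemma isTemperedFun_oscTerm (k : ℕ) (n : ℕ+) : IsTemperedFun (oscTerm k n) := by
  have hc : Continuous (oscTerm k n) := by unfold oscTerm; fun_prop
  unfold oscTerm at *
  generalize -(1 / Real.pi) * ((r3 n : ℝ) / (n : ℝ)) * (1 / (2 * Real.pi * √(n : ℝ)) ^ k) = a at *
  generalize ((k : ℝ) + 1) / (2 * Real.pi * √(n : ℝ)) * (Complex.I ^ k).im = d at *
  generalize ((k : ℝ) + 1) / (2 * Real.pi * √(n : ℝ)) * (Complex.I ^ k).re = e at *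
  generalize (Complex.I ^ k).re = b at *
  generalize (Complex.I ^ k).im = c at *
  generalize 2 * Real.pi * √(n : ℝ) = w at *
  refine isTemperedFun_of_bound hc.aestronglyMeasurable (|a| * (|b| + |c| + |d| + |e|)) 1
    fun x hx => ?_
  have hx1 : x ≤ 1 + x ^ 2 := by nlinarith [sq_nonneg (x - 1)]
  have h1 : (1 : ℝ) ≤ 1 + x ^ 2 := by nlinarith
  have hcos := Real.abs_cos_le_one (w * x)
  have hsin := Real.abs_sin_le_one (w * x)
  have e1 : |b * (x * Real.cos (w * x))| ≤ |b| * (1 + x ^ 2) := by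
    rw [abs_mul, abs_mul, abs_of_nonneg hx]
    gcongr
    nlinarith
  have e2 : |c * (x * Real.sin (w * x))| ≤ |c| * (1 + x ^ 2) := by
    rw [abs_mul, abs_mul, abs_of_nonneg hx]
    gcongr
    nlinarith
  have e3 : |d * Real.cos (w * x)| ≤ |d| * (1 + x ^ 2) := by
    rw [abs_mul]
    gcongr
    linarith
  have e4 : |e * Real.sin (w * x)| ≤ |e| * (1 + x ^ 2) := by
    rw [abs_mul]
    gcongr
    linarith
  rw [abs_mul, pow_one, mul_assoc]
  gcongr
  refine (abs_sub _ _).trans ?_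
  have t1 := abs_add_le (b * (x * Real.cos (w * x)) + c * (x * Real.sin (w * x)))
    (d * Real.cos (w * x))
  have t2 := abs_add_le (b * (x * Real.cos (w * x))) (c * (x * Real.sin (w * x)))
  linarith

lemma ball_subset (R : ℝ) : {a : Fin 3 → ℤ |
    ‖(WithLp.toLp 2 (fun i => (a i : ℝ)) : EuclideanSpace ℝ (Fin 3))‖ ≤ R} ⊆
    ((Fintype.piFinset fun _ : Fin 3 => Finset.Icc (-⌊R⌋) ⌊R⌋ : Finset (Fin 3 → ℤ)) :
      Set (Fin 3 → ℤ)) := by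
  intro a ha
  simp only [Finset.mem_coe, Fintype.mem_piFinset, Finset.mem_Icc]
  intro i
  have h := (PiLp.norm_apply_le (WithLp.toLp 2 (fun i => (a i : ℝ)) :
    EuclideanSpace ℝ (Fin 3)) i).trans ha
  simp only [Real.norm_eq_abs] at h
  have h' := abs_le.1 h
  refine ⟨?_, Int.le_floor.2 h'.2⟩
  have : -a i ≤ ⌊R⌋ := Int.le_floor.2 (by push_cast; linarith [h'.1])
  linarith

lemma N3_mono : Monotone N3 := by
  intro x y hxy
  unfold N3
  exact_mod_cast Set.ncard_le_ncard (fun a ha => le_trans ha hxy)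
    ((Finset.finite_toSet _).subset (ball_subset y))

lemma N3_bound (x : ℝ) (hx : 0 ≤ x) : |N3 x| ≤ 27 * (1 + x ^ 2) ^ 3 := by
  have h1 : N3 x ≤ ((Fintype.piFinset fun _ : Fin 3 => Finset.Icc (-⌊x⌋) ⌊x⌋).card : ℝ) := by
    unfold N3
    rw [← Set.ncard_coe_finset]
    exact_mod_cast Set.ncard_le_ncard (ball_subset x) (Finset.finite_toSet _)
  have h0 : 0 ≤ N3 x := by unfold N3; positivity
  rw [abs_of_nonneg h0]
  refine h1.trans ?_
  rw [Fintype.card_piFinset]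
  simp only [Int.card_Icc, Finset.prod_const, Finset.card_univ, Fintype.card_fin]
  push_cast
  have hf : (0 : ℤ) ≤ ⌊x⌋ := Int.floor_nonneg.2 hx
  have h2 : (((⌊x⌋ + 1 - -⌊x⌋).toNat : ℕ) : ℝ) ≤ 3 * (1 + x ^ 2) := by
    have h3 : (((⌊x⌋ + 1 - -⌊x⌋).toNat : ℕ) : ℤ) = ⌊x⌋ + 1 - -⌊x⌋ := Int.toNat_of_nonneg (by omega)
    have h4 : (((⌊x⌋ + 1 - -⌊x⌋).toNat : ℕ) : ℝ) = (⌊x⌋ : ℝ) + 1 - -(⌊x⌋ : ℝ) := by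
      exact_mod_cast h3
    rw [h4]
    nlinarith [Int.floor_le x, sq_nonneg (x - 1)]
  calc _ ≤ (3 * (1 + x ^ 2)) ^ 3 := pow_le_pow_left₀ (by positivity) h2 3
    _ = _ := by ring

lemma N3k_aux (k : ℕ) : (∀ a b, IntervalIntegrable (N3k k) volume a b) ∧
    AEStronglyMeasurable (N3k k) volume ∧
    ∃ (A : ℝ) (K : ℕ), ∀ x, 0 ≤ x → |N3k k x| ≤ A * (1 + x ^ 2) ^ K := by
  induction k with
  | zero =>
    exact ⟨fun a b => N3_mono.intervalIntegrable, N3_mono.measurable.aestronglyMeasurable,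
      27, 3, N3_bound⟩
  | succ k ih =>
    obtain ⟨hi, hm, A, K, hb⟩ := ih
    have hc : Continuous (N3k (k + 1)) := intervalIntegral.continuous_primitive hi 0
    refine ⟨fun a b => hc.intervalIntegrable a b, hc.aestronglyMeasurable, A, K + 1,
      fun x hx => ?_⟩
    have hA : 0 ≤ A := by
      have := (abs_nonneg _).trans (hb 0 le_rfl)
      simpa using this
    have h := intervalIntegral.norm_integral_le_of_norm_le_const (a := 0) (b := x)
      (f := N3k k) (C := A * (1 + x ^ 2) ^ K) (fun y hy => by
        rw [uIoc_of_le hx] at hy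
        have hy0 := hy.1.le
        have hyx := hy.2
        refine (hb y hy.1.le).trans ?_
        gcongr)
    rw [sub_zero, abs_of_nonneg hx] at h
    refine h.trans ?_
    rw [pow_succ (1 + x ^ 2) K, ← mul_assoc]
    gcongr
    nlinarith [sq_nonneg (x - 1)]

lemma isTemperedFun_N3k (k : ℕ) : IsTemperedFun (N3k k) := by
  obtain ⟨-, hm, A, K, hb⟩ := N3k_aux k
  exact isTemperedFun_of_bound hm.restrict A K hb

/-! ### The supported distributions in the formula -/

/-- `N_{3,k}` as a supported distribution. -/
noncomputable def N3kDist (k : ℕ) : SupportedDist := ofFun (N3k k) (isTemperedFun_N3k k)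

/-- The non-oscillatory part as a supported distribution. -/
noncomputable def polyDist (k : ℕ) : SupportedDist := ofFun (polyPart k) (isTemperedFun_polyPart k)

/-- The `n`-th term of the oscillatory series as a supported distribution. -/
noncomputable def oscTermDist (k : ℕ) (n : ℕ+) : SupportedDist :=
  ofFun (oscTerm k n) (isTemperedFun_oscTerm k n)

/-- `o_k`, the sum of the oscillatory series in the space of supported distributions. -/
noncomputable def oscDist (k : ℕ) : SupportedDist := ∑' n : ℕ+, oscTermDist k n

end GaussSphere

/-!
# Lattice points in balls of `ℝ³`: the iterated integrals of the counting function

The second iterated integral is a lattice sum, `N3k 2 R = ∑_a (R - |a|)₊² / 2`, of a continuous,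
compactly supported radial function `radialSq R` on `ℝ³`. Rotating the frequency onto a coordinate
axis and integrating over slices evaluates its Fourier transform: it is elementary
(`integral_cos_truncTail`) and decays like `|ξ|⁻⁴`, hence is summable over `ℤ³`. Poisson summation
(`hasSum_poisson`) therefore applies in its simplest form, the pointwise convergence of the Fourier
series of the periodization on the torus, and grouping the frequencies into shells
(`hasSum_shells`) yields the formula for `k = 2` at every `R ≥ 0`.

All other `k` follow from this one, because `oscTerm (k + 1) n` is a primitive of `oscTerm k n`,
`polyPart (k + 1)` is a primitive of `polyPart k`, and the values of these primitives at the origin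
cancel: `∑ₙ oscTerm (k + 1) n 0 = -C k = -polyPart (k + 1) 0` (`hasSum_oscTerm_succ_zero`).
Going up, the formula is integrated over `[0, x]` (`N3k_eq`); for `k ≥ 2` the series is dominated
by `∑ r3 n / n²`, which gives the uniform convergence and the formula in the space of distributions.
Going down to `k = 1` and `k = 0`, where no such domination is available, the formula for
`k + 1` is tested against `χ'` (`PairingFormula.of_succ`). Integration by parts on `[0, ∞)` produces
boundary terms at the origin, and these cancel by the same identity.
-/

open scoped SchwartzMap

namespace GaussSphere

open MeasureTheory Set

/-! ### Summation over the lattice by shells -/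

/-- The squared Euclidean length of a lattice point, as a natural number. -/
def sqLen (a : Fin 3 → ℤ) : ℕ := ∑ i, (a i).natAbs ^ 2

lemma sqLen_cast (a : Fin 3 → ℤ) : (sqLen a : ℝ) = ∑ i, (a i : ℝ) ^ 2 := by
  have h : ((sqLen a : ℕ) : ℤ) = ∑ i, a i ^ 2 := by simp [sqLen]
  exact_mod_cast congrArg (Int.cast (R := ℝ)) h

lemma r3_eq_card_preimage (n : ℕ) : r3 n = Nat.card (sqLen ⁻¹' {n}) := by
  rw [r3, Nat.card_coe_set_eq]
  congr 1
  ext a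
  have h : ((sqLen a : ℕ) : ℤ) = ∑ i, a i ^ 2 := by simp [sqLen]
  simp only [mem_ofPred_eq, mem_preimage, mem_singleton_iff, ← h]
  norm_cast

lemma norm_lattice (a : Fin 3 → ℤ) :
    ‖(WithLp.toLp 2 (fun i => (a i : ℝ)) : EuclideanSpace ℝ (Fin 3))‖ = √(sqLen a) := by
  rw [EuclideanSpace.norm_eq, sqLen_cast]
  simp

lemma sqLen_eq_zero {a : Fin 3 → ℤ} : sqLen a = 0 ↔ a = 0 := by
  simp [sqLen, Finset.sum_eq_zero_iff, funext_iff]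

lemma r3_zero : r3 0 = 1 := by
  rw [r3_eq_card_preimage, Nat.card_coe_set_eq, Set.ncard_eq_one]
  exact ⟨0, by ext a; simp [sqLen_eq_zero]⟩

/-- Summing a function of the squared length over `ℤ³` shell by shell produces the weights
`r3 n`. -/
lemma hasSum_shells {E : Type*} [NormedAddCommGroup E] [NormedSpace ℝ E] [CompleteSpace E]
    {f : ℕ → E} {s : E}
    (hf : HasSum (fun a : Fin 3 → ℤ => f (sqLen a)) s) :
    HasSum (fun n : ℕ => (r3 n : ℝ) • f n) s := by
  have h := hf.tsum_fiberwise sqLen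
  refine h.congr_fun fun n => ?_
  have : ∀ b : sqLen ⁻¹' {n}, f (sqLen b) = f n := fun b => by rw [b.2]
  simp_rw [this]
  rw [tsum_const, r3_eq_card_preimage, Nat.cast_smul_eq_nsmul]

/-- The contribution of the origin split off from a sum over `ℕ`. -/
lemma hasSum_pnat {E : Type*} [NormedAddCommGroup E] {f : ℕ → E} {s : E}
    (hf : HasSum f s) : HasSum (fun n : ℕ+ => f n) (s - f 0) := by
  have h1 : HasSum (fun n : ℕ => f (n + 1)) (s - f 0) := by
    rw [hasSum_nat_add_iff (f := f) 1]
    simpa using hf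
  rw [← Equiv.pnatEquivNat.symm.hasSum_iff]
  exact h1

lemma abs_le_sqrt_sqLen (a : Fin 3 → ℤ) (i : Fin 3) : |(a i : ℝ)| ≤ √(sqLen a) := by
  rw [sqLen_cast]
  apply Real.abs_le_sqrt
  exact Finset.single_le_sum (f := fun i => (a i : ℝ) ^ 2) (fun j _ => sq_nonneg _)
    (Finset.mem_univ i)

/-- `∑ |a|⁻⁴` converges over `ℤ³`, as `4 > 3`. -/
lemma summable_sqLen : Summable fun a : Fin 3 → ℤ => ((sqLen a : ℝ) ^ 2)⁻¹ := by
  set L := Submodule.span ℤ (Set.range (Pi.basisFun ℝ (Fin 3)))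
  let b : Module.Basis (Fin 3) ℤ L := (Pi.basisFun ℝ (Fin 3)).restrictScalars ℤ
  have hr : Module.finrank ℤ L = 3 := by rw [Module.finrank_eq_card_basis b]; simp
  have h := ZLattice.summable_norm_pow_inv L 4 (by omega)
  rw [← b.equivFun.symm.toEquiv.summable_iff] at h
  have hv : ∀ a : Fin 3 → ℤ, ((b.equivFun.symm a : L) : Fin 3 → ℝ) = fun i => (a i : ℝ) := by
    intro a
    rw [Module.Basis.equivFun_symm_apply]
    have hb : ∀ i, ((b i : L) : Fin 3 → ℝ) = Pi.single i 1 := fun i => by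
      rw [Module.Basis.restrictScalars_apply, Pi.basisFun_apply]
    ext j
    simp [hb, Pi.single_apply]
  refine Summable.of_nonneg_of_le (fun a => by positivity) (fun a => ?_) h
  change _ ≤ ‖((b.equivFun.symm a : L) : Fin 3 → ℝ)‖⁻¹ ^ 4
  rw [hv]
  rcases eq_or_ne a 0 with rfl | ha
  · simp [sqLen]
  have hne : (fun i => (a i : ℝ)) ≠ 0 := by
    intro h0; apply ha; ext i; simpa using congrFun h0 i
  have hle : ‖(fun i => (a i : ℝ))‖ ≤ √(sqLen a) :=
    (pi_norm_le_iff_of_nonneg (Real.sqrt_nonneg _)).2 fun i => abs_le_sqrt_sqLen a i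
  have hpos := norm_pos_iff.2 hne
  rw [inv_pow]
  apply inv_anti₀ (by positivity)
  calc _ ≤ √(sqLen a : ℝ) ^ 4 := pow_le_pow_left₀ hpos.le hle 4
    _ = _ := by
      rw [show (4 : ℕ) = 2 * 2 from rfl, pow_mul, Real.sq_sqrt (Nat.cast_nonneg _)]

lemma summable_r3 : Summable fun n : ℕ+ => (r3 n : ℝ) * ((n : ℝ) ^ 2)⁻¹ := by
  have h := hasSum_pnat (hasSum_shells (f := fun n : ℕ => ((n : ℝ) ^ 2)⁻¹) summable_sqLen.hasSum)
  exact h.summable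

lemma summable_r3_rpow {s : ℝ} (hs : s ≤ -2) :
    Summable fun n : ℕ+ => (r3 n : ℝ) * (n : ℝ) ^ s := by
  refine Summable.of_nonneg_of_le (fun n => by positivity) (fun n => ?_) summable_r3
  gcongr
  have h1 : (1 : ℝ) ≤ n := by exact_mod_cast one_le
  calc (n : ℝ) ^ s ≤ (n : ℝ) ^ (-2 : ℝ) := Real.rpow_le_rpow_of_exponent_le h1 hs
    _ = _ := by rw [Real.rpow_neg (by positivity)]; norm_cast

/-! ### Poisson summation for compactly supported functions -/

section Periodization

variable {d : Type*}

/-- The cube `(0, 1]^d`, a fundamental domain for `ℤ^d`. -/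
def unitCube (d : Type*) : Set (d → ℝ) := {x | ∀ i, x i ∈ Ioc (0 : ℝ) (0 + 1)}

/-- The inclusion of `ℤ^d` in `ℝ^d`. -/
def latticePt (m : d → ℤ) : d → ℝ := fun i => (m i : ℝ)

/-- The covering map `ℝ^d → (ℝ/ℤ)^d`. -/
def toTorus (x : d → ℝ) : UnitAddTorus d := fun i => (x i : UnitAddCircle)

lemma measurableSet_unitCube [Finite d] : MeasurableSet (unitCube d) :=
  MeasurableSet.univ_pi' fun _ => measurableSet_Ioc

lemma toTorus_add_latticePt (x : d → ℝ) (m : d → ℤ) :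
    toTorus (x + latticePt m) = toTorus x := by
  ext i
  simp [toTorus, latticePt]

lemma toTorus_eq_iff {x y : d → ℝ} : toTorus x = toTorus y ↔ ∃ m, y = x + latticePt m := by
  constructor
  · intro h
    have h' : ∀ i, ∃ n : ℤ, y i = x i + n := fun i => by
      have hi : ((y i - x i : ℝ) : UnitAddCircle) = 0 := by
        rw [AddCircle.coe_sub, sub_eq_zero]
        exact (congrFun h i).symm
      obtain ⟨n, hn⟩ := (AddCircle.coe_eq_zero_iff (1 : ℝ)).1 hi
      refine ⟨n, ?_⟩
      rw [zsmul_one] at hn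
      linarith
    choose m hm using h'
    exact ⟨m, funext hm⟩
  · rintro ⟨m, rfl⟩
    rw [toTorus_add_latticePt]

lemma isOpenQuotientMap_toTorus : IsOpenQuotientMap (toTorus (d := d)) := by
  have : IsOpenQuotientMap (Pi.map fun _ : d => ((↑) : ℝ → UnitAddCircle)) :=
    IsOpenQuotientMap.piMap fun _ => QuotientAddGroup.isOpenQuotientMap_mk
  exact this

/-- Unfolding: an integral over `ℝ^d` is the sum of the integrals over the translates of the unit
cube. -/
lemma hasSum_integral_cube [Fintype d] {f : (d → ℝ) → ℂ} (hf : Integrable f) :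
    HasSum (fun m : d → ℤ => ∫ x in unitCube d, f (x + latticePt m)) (∫ x, f x) := by
  have key : ∀ m : d → ℤ, ∫ x in unitCube d, f (x + latticePt m) =
      ∫ x in {x | x - latticePt m ∈ unitCube d}, f x := by
    intro m
    have := (measurePreserving_add_right (volume : Measure (d → ℝ))
      (latticePt m)).setIntegral_preimage_emb (measurableEmbedding_addRight _) f
      {x | x - latticePt m ∈ unitCube d}
    rw [← this]
    congr 2
    ext x
    simp
  simp_rw [key]
  have hU : (⋃ m : d → ℤ, {x | x - latticePt m ∈ unitCube d}) = univ := by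
    refine eq_univ_of_forall fun x => mem_iUnion.2 ⟨fun i => ⌈x i⌉ - 1, fun i => ?_⟩
    simp only [Pi.sub_apply, latticePt, Int.cast_sub, Int.cast_one, mem_Ioc]
    have h1 := Int.ceil_lt_add_one (x i)
    have h2 := Int.le_ceil (x i)
    constructor <;> linarith
  have := hasSum_integral_iUnion (μ := volume) (f := f)
    (s := fun m : d → ℤ => {x | x - latticePt m ∈ unitCube d})
    (fun m => (measurable_id.sub_const _) measurableSet_unitCube) ?_ (by rwa [hU, integrableOn_univ])
  · rwa [hU, setIntegral_univ] at this
  · intro m n hmn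
    refine Set.disjoint_left.2 fun x hx hy => hmn ?_
    ext i
    have h1 := hx i
    have h2 := hy i
    simp only [Pi.sub_apply, latticePt, mem_Ioc] at h1 h2
    have h3 : (m i : ℝ) < n i + 1 := by linarith [h1.1, h2.2]
    have h4 : (n i : ℝ) < m i + 1 := by linarith [h2.1, h1.2]
    norm_cast at h3 h4
    omega

lemma locallyFinite_translates [Fintype d] {φ : (d → ℝ) → ℂ} (hs : HasCompactSupport φ) :
    LocallyFinite fun m : d → ℤ => Function.support fun x => φ (x + latticePt m) := by
  obtain ⟨R, hR⟩ := hs.isCompact.isBounded.exists_norm_le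
  intro x
  refine ⟨Metric.ball x 1, Metric.ball_mem_nhds x one_pos, ?_⟩
  refine ((Set.Finite.pi' fun _ : d => Set.finite_Icc (-⌈R + ‖x‖ + 1⌉) ⌈R + ‖x‖ + 1⌉)).subset ?_
  rintro m ⟨y, hy, hyx⟩ i
  have h1 : ‖y + latticePt m‖ ≤ R := hR _ (subset_tsupport _ hy)
  have h2 : ‖y‖ ≤ ‖x‖ + 1 := by
    have := norm_le_norm_add_norm_sub' y x
    rw [Metric.mem_ball, dist_eq_norm] at hyx
    linarith
  have h3 : ‖latticePt m‖ ≤ R + ‖x‖ + 1 := by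
    have := norm_sub_le (y + latticePt m) y
    rw [add_sub_cancel_left] at this
    linarith
  have h4 : |(m i : ℝ)| ≤ R + ‖x‖ + 1 := (norm_le_pi_norm (latticePt m) i).trans h3
  have h5 := h4.trans (Int.le_ceil _)
  norm_cast at h5
  exact abs_le.1 h5

/-- **Poisson summation** for a continuous compactly supported function on `ℝ^d` whose Fourier
transform is summable over `ℤ^d`: the periodization is a continuous function on the torus, whose
Fourier coefficients are values of the Fourier transform. -/
theorem hasSum_poisson [Fintype d] {φ : (d → ℝ) → ℂ} (hc : Continuous φ) (hs : HasCompactSupport φ)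
    (hsum : Summable fun m : d → ℤ => ∫ x, UnitAddTorus.mFourier (-m) (toTorus x) * φ x) :
    HasSum (fun m : d → ℤ => ∫ x, UnitAddTorus.mFourier (-m) (toTorus x) * φ x)
      (∑ᶠ m : d → ℤ, φ (latticePt m)) := by
  set G : (d → ℝ) → ℂ := fun x => ∑ᶠ m : d → ℤ, φ (x + latticePt m) with hG
  have hlf := locallyFinite_translates hs
  have hGc : Continuous G := continuous_finsum (fun m => by fun_prop) hlf
  have hper : ∀ x m, G (x + latticePt m) = G x := by
    intro x m
    simp only [hG]
    rw [← finsum_comp_equiv (Equiv.addLeft m) (f := fun n => φ (x + latticePt n))]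
    refine finsum_congr fun n => ?_
    congr 1
    ext i
    simp [latticePt]
    ring
  have hq := isOpenQuotientMap_toTorus (d := d)
  let s := Function.surjInv hq.surjective
  let F : UnitAddTorus d → ℂ := fun t => G (s t)
  have hF : ∀ x, F (toTorus x) = G x := by
    intro x
    obtain ⟨m, hm⟩ := toTorus_eq_iff.1 (Function.surjInv_eq hq.surjective (toTorus x))
    change G (Function.surjInv hq.surjective (toTorus x)) = G x
    conv_rhs => rw [hm, hper]
  have hFc : Continuous F := by
    rw [hq.isQuotientMap.continuous_iff]
    exact hGc.congr fun x => (hF x).symm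
  have hcoef : ∀ m : d → ℤ, UnitAddTorus.mFourierCoeff (⟨F, hFc⟩ : C(UnitAddTorus d, ℂ)) m =
      ∫ x, UnitAddTorus.mFourier (-m) (toTorus x) * φ x := by
    intro m
    have hcm : Continuous fun x : d → ℝ => UnitAddTorus.mFourier (-m) (toTorus x) :=
      (UnitAddTorus.mFourier (-m)).continuous.comp hq.continuous
    have hint : Integrable fun x => UnitAddTorus.mFourier (-m) (toTorus x) * φ x :=
      (hcm.mul hc).integrable_of_hasCompactSupport hs.mul_left
    rw [UnitAddTorus.mFourierCoeff_eq_integral _ m 0]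
    have h := hasSum_integral_cube hint
    change ∫ x in unitCube d, UnitAddTorus.mFourier (-m) (toTorus x) • F (toTorus x) = _
    -- only finitely many translates of the support meet the cube, so the sum over translates is
    -- finite there and may be interchanged with the integral
    obtain ⟨K, hK, hsub⟩ : ∃ K : Set (d → ℝ), IsCompact K ∧ unitCube d ⊆ K :=
      ⟨Set.pi univ fun _ => Icc 0 1, isCompact_univ_pi fun _ => isCompact_Icc,
        fun x hx i _ => ⟨(hx i).1.le, by simpa using (hx i).2⟩⟩
    have hfin := hlf.finite_nonempty_inter_compact hK
    have hzero : ∀ n : d → ℤ, n ∉ hfin.toFinset → ∀ x ∈ unitCube d, φ (x + latticePt n) = 0 := by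
      intro n hn x hx
      by_contra hne
      exact hn (hfin.mem_toFinset.2 ⟨x, hne, hsub hx⟩)
    have h2 : HasSum (fun n : d → ℤ => ∫ x in unitCube d,
        UnitAddTorus.mFourier (-m) (toTorus (x + latticePt n)) * φ (x + latticePt n))
        (∑ n ∈ hfin.toFinset, ∫ x in unitCube d,
        UnitAddTorus.mFourier (-m) (toTorus (x + latticePt n)) * φ (x + latticePt n)) := by
      refine hasSum_sum_of_ne_finset_zero fun n hn => ?_
      exact setIntegral_eq_zero_of_forall_eq_zero fun x hx => by rw [hzero n hn x hx, mul_zero]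
    rw [h.unique h2, ← integral_finsetSum]
    · refine setIntegral_congr_fun measurableSet_unitCube fun x hx => ?_
      simp only [hF, toTorus_add_latticePt, ← Finset.mul_sum, smul_eq_mul]
      congr 1
      refine finsum_eq_sum_of_support_subset _ fun n hn => ?_
      by_contra hne
      exact hn (hzero n hne x hx)
    · intro n _
      exact (hint.comp_add_right (latticePt n)).integrableOn
  have h := UnitAddTorus.hasSum_mFourier_series_apply_of_summable (f := ⟨F, hFc⟩)
    (by simpa only [funext hcoef] using hsum) (toTorus 0)
  have h1 : ∀ m : d → ℤ, UnitAddTorus.mFourier m (toTorus (0 : d → ℝ)) = 1 := by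
    intro m
    simp [UnitAddTorus.mFourier, toTorus]
  simp only [h1, smul_eq_mul, mul_one] at h
  rw [funext hcoef] at h
  convert h using 1
  simp [hF, hG]

end Periodization

/-! ### The Fourier transform of a truncated power -/

/-- The squared truncated power `(R - r)₊² / 2`, the second iterated integral in `R` of the
indicator of `r ≤ R`. -/
noncomputable def truncSq (R r : ℝ) : ℝ := max (R - r) 0 ^ 2 / 2

/-- The integral of `t ↦ t * truncSq R t` over `[r, ∞)`. -/
noncomputable def truncTail (R r : ℝ) : ℝ := R * max (R - r) 0 ^ 3 / 6 - max (R - r) 0 ^ 4 / 8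

lemma continuous_truncSq (R : ℝ) : Continuous (truncSq R) := by
  unfold truncSq; fun_prop

lemma continuous_truncTail (R : ℝ) : Continuous (truncTail R) := by
  unfold truncTail; fun_prop

lemma truncSq_of_le {R r : ℝ} (h : R ≤ r) : truncSq R r = 0 := by
  simp [truncSq, h]

lemma truncTail_of_le {R r : ℝ} (h : R ≤ r) : truncTail R r = 0 := by
  simp [truncTail, h]

lemma truncTail_of_ge {R r : ℝ} (h : r ≤ R) :
    truncTail R r = R * (R - r) ^ 3 / 6 - (R - r) ^ 4 / 8 := by
  rw [truncTail, max_eq_left (by linarith)]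

lemma hasDerivAt_posPart_pow (k : ℕ) (x : ℝ) :
    HasDerivAt (fun x : ℝ => max x 0 ^ (k + 2)) ((k + 2) * max x 0 ^ (k + 1)) x := by
  rcases lt_trichotomy x 0 with h | rfl | h
  · rw [max_eq_right h.le]
    have : HasDerivAt (fun _ : ℝ => (0 : ℝ)) 0 x := hasDerivAt_const x 0
    simp only [ne_eq, Nat.add_eq_zero_iff, one_ne_zero, and_false, not_false_eq_true, zero_pow,
      mul_zero]
    refine this.congr_of_eventuallyEq ?_
    filter_upwards [Iio_mem_nhds h] with y hy
    rw [max_eq_right (le_of_lt hy)]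
    simp
  · simp only [max_self, ne_eq, Nat.add_eq_zero_iff, one_ne_zero, and_false, not_false_eq_true,
      zero_pow, mul_zero]
    rw [hasDerivAt_iff_isLittleO_nhds_zero]
    simp only [zero_add, max_self, ne_eq, Nat.add_eq_zero_iff, OfNat.ofNat_ne_zero, and_false,
      not_false_eq_true, zero_pow, sub_zero, smul_zero]
    have h1 : (fun h : ℝ => h ^ (k + 2)) =o[nhds 0] fun h => h := by
      simpa using Asymptotics.isLittleO_pow_pow (𝕜 := ℝ) (m := 1) (n := k + 2) (by omega)
    refine Asymptotics.IsBigO.trans_isLittleO ?_ h1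
    refine Asymptotics.IsBigO.of_bound 1 (Filter.Eventually.of_forall fun h => ?_)
    rw [one_mul, norm_pow, norm_pow]
    gcongr
    rcases le_total h 0 with h0 | h0
    · simp [h0]
    · simp [h0]
  · rw [max_eq_left h.le]
    have := hasDerivAt_pow (k + 2) x
    simp only [Nat.cast_add, Nat.cast_ofNat, Nat.add_succ_sub_one] at this
    refine this.congr_of_eventuallyEq ?_
    filter_upwards [Ioi_mem_nhds h] with y hy
    rw [max_eq_left (le_of_lt hy)]

lemma hasDerivAt_truncTail (R r : ℝ) : HasDerivAt (truncTail R) (-(r * truncSq R r)) r := by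
  have h0 : HasDerivAt (fun r : ℝ => R - r) (-1) r := by
    simpa using (hasDerivAt_id r).const_sub R
  have h1 := (hasDerivAt_posPart_pow 1 (R - r)).comp r h0
  have h2 := (hasDerivAt_posPart_pow 2 (R - r)).comp r h0
  refine (((h1.const_mul R).div_const 6).sub (h2.div_const 8)).congr_deriv ?_
  rw [truncSq]
  push_cast
  rcases le_total R r with h | h
  · rw [max_eq_right (by linarith)]
    ring
  · rw [max_eq_left (by linarith)]
    ring

/-- The integral over the plane orthogonal to an axis, at height `s`. -/
lemma integral_slice (R s : ℝ) :
    ∫ z : EuclideanSpace ℝ (Fin 2), truncSq R √(s ^ 2 + ‖z‖ ^ 2) =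
      2 * Real.pi * truncTail R |s| := by
  rw [integral_fun_norm_addHaar (μ := volume) (fun ρ : ℝ => truncSq R √(s ^ 2 + ρ ^ 2))]
  have hd : ∀ ρ ∈ Ioi (0 : ℝ), HasDerivAt (fun ρ => -truncTail R √(s ^ 2 + ρ ^ 2))
      (ρ * truncSq R √(s ^ 2 + ρ ^ 2)) ρ := by
    intro ρ hρ
    have hρ0 : (0 : ℝ) < ρ := hρ
    have hpos : 0 < s ^ 2 + ρ ^ 2 := by positivity
    have h1 : HasDerivAt (fun ρ : ℝ => s ^ 2 + ρ ^ 2) (2 * ρ) ρ := by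
      simpa using (hasDerivAt_pow 2 ρ).const_add (s ^ 2)
    have h2 := h1.sqrt hpos.ne'
    have h3 := ((hasDerivAt_truncTail R √(s ^ 2 + ρ ^ 2)).comp ρ h2).neg
    refine h3.congr_deriv ?_
    have := (Real.sqrt_pos.2 hpos).ne'
    field_simp
  have hzero : ∀ ρ : ℝ, |R| ≤ ρ → R ≤ √(s ^ 2 + ρ ^ 2) := by
    intro ρ hρ
    refine (le_abs_self R).trans (hρ.trans ?_)
    exact Real.le_sqrt_of_sq_le (by nlinarith [sq_nonneg s])
  have hval : ∫ ρ in Ioi (0 : ℝ), ρ * truncSq R √(s ^ 2 + ρ ^ 2) = truncTail R |s| := by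
    have hint : IntegrableOn (fun ρ => ρ * truncSq R √(s ^ 2 + ρ ^ 2)) (Ioi 0) := by
      refine (Continuous.integrable_of_hasCompactSupport ?_ ?_).integrableOn
      · have := continuous_truncSq R
        fun_prop
      · refine HasCompactSupport.intro (isCompact_Icc (a := -|R|) (b := |R|)) fun ρ hρ => ?_
        have : |R| ≤ |ρ| := by
          by_contra hlt
          exact hρ (abs_le.1 (not_le.1 hlt).le)
        have h := hzero |ρ| this
        rw [sq_abs] at h
        rw [truncSq_of_le h, mul_zero]
    have ht : Filter.Tendsto (fun ρ => -truncTail R √(s ^ 2 + ρ ^ 2)) Filter.atTop (nhds 0) := by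
      refine tendsto_const_nhds.congr' ?_
      filter_upwards [Filter.eventually_ge_atTop |R|] with ρ hρ
      rw [truncTail_of_le (hzero ρ hρ), neg_zero]
    have hcont : ContinuousWithinAt (fun ρ => -truncTail R √(s ^ 2 + ρ ^ 2)) (Ici 0) 0 := by
      have := continuous_truncTail R
      exact Continuous.continuousWithinAt (by fun_prop)
    rw [integral_Ioi_of_hasDerivAt_of_tendsto hcont hd hint ht]
    simp [Real.sqrt_sq_eq_abs]
  simp only [finrank_euclideanSpace, Fintype.card_fin, Nat.add_one_sub_one, pow_one, smul_eq_mul,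
    hval]
  rw [measureReal_def, EuclideanSpace.volume_ball_fin_two]
  simp [ENNReal.toReal_ofReal Real.pi_pos.le]
  ring

/-- The cosine transform of `truncTail`, at a nonzero frequency. The first boundary terms at both
ends vanish, which is what makes the leading decay `w⁻⁴`. -/
lemma integral_cos_truncTail {R w : ℝ} (hw : w ≠ 0) :
    ∫ s in (0 : ℝ)..R, Real.cos (w * s) * (R * (R - s) ^ 3 / 6 - (R - s) ^ 4 / 8) =
      R * Real.cos (w * R) / w ^ 4 + 2 * R / w ^ 4 - 3 * Real.sin (w * R) / w ^ 5 := by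
  -- the antiderivative obtained by integrating by parts five times
  have hd : ∀ s : ℝ, HasDerivAt (fun s =>
      (R * (R - s) ^ 3 / 6 - (R - s) ^ 4 / 8) * Real.sin (w * s) / w
      - (R * (R - s) ^ 2 / 2 - (R - s) ^ 3 / 2) * Real.cos (w * s) / w ^ 2
      - (R * (R - s) - 3 * (R - s) ^ 2 / 2) * Real.sin (w * s) / w ^ 3
      + (R - 3 * (R - s)) * Real.cos (w * s) / w ^ 4
      - 3 * Real.sin (w * s) / w ^ 5)
      (Real.cos (w * s) * (R * (R - s) ^ 3 / 6 - (R - s) ^ 4 / 8)) s := by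
    intro s
    have hu : HasDerivAt (fun s : ℝ => R - s) (-1) s := by
      simpa using (hasDerivAt_id s).const_sub R
    have hl : HasDerivAt (fun s : ℝ => w * s) w s := by
      simpa using (hasDerivAt_id s).const_mul w
    have hs := hl.sin
    have hc := hl.cos
    refine ((((((((((hu.pow 3).const_mul R).div_const 6).sub ((hu.pow 4).div_const 8)).mul
      hs).div_const w).sub (((((hu.pow 2).const_mul R).div_const 2).sub
      ((hu.pow 3).div_const 2)).mul hc |>.div_const (w ^ 2))).sub
      (((hu.const_mul R).sub (((hu.pow 2).const_mul 3).div_const 2)).mul hs |>.div_const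
      (w ^ 3))).add (((hu.const_mul 3).const_sub R).mul hc |>.div_const (w ^ 4))).sub
      ((hs.const_mul 3).div_const (w ^ 5))).congr_deriv ?_
    simp
    field_simp
    ring
  rw [intervalIntegral.integral_eq_sub_of_hasDerivAt (fun s _ => hd s)
    (Continuous.intervalIntegrable (by fun_prop) _ _)]
  simp
  ring

lemma integral_truncTail_zero (R : ℝ) :
    ∫ s in (0 : ℝ)..R, (R * (R - s) ^ 3 / 6 - (R - s) ^ 4 / 8) = R ^ 5 / 60 := by
  have hd : ∀ s : ℝ, HasDerivAt (fun s => -(R * (R - s) ^ 4 / 24) + (R - s) ^ 5 / 40)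
      (R * (R - s) ^ 3 / 6 - (R - s) ^ 4 / 8) s := by
    intro s
    have hu : HasDerivAt (fun s : ℝ => R - s) (-1) s := by
      simpa using (hasDerivAt_id s).const_sub R
    refine ((((hu.pow 4).const_mul R).div_const 24).neg.add ((hu.pow 5).div_const 40)).congr_deriv ?_
    simp
    ring
  rw [intervalIntegral.integral_eq_sub_of_hasDerivAt (fun s _ => hd s)
    (Continuous.intervalIntegrable (by fun_prop) _ _)]
  simp
  ring

/-- The Fourier transform of `s ↦ truncTail R |s|` on the line as a cosine transform. -/
lemma integral_exp_truncTail {R : ℝ} (hR : 0 ≤ R) (w : ℝ) :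
    ∫ s : ℝ, Complex.exp (-(w * s : ℝ) * Complex.I) * (truncTail R |s| : ℂ) =
      ((2 * ∫ s in (0 : ℝ)..R, Real.cos (w * s) * (R * (R - s) ^ 3 / 6 - (R - s) ^ 4 / 8) : ℝ) :
        ℂ) := by
  set F : ℝ → ℂ := fun s => Complex.exp (-(w * s : ℝ) * Complex.I) * (truncTail R |s| : ℂ) with hF
  have hct := continuous_truncTail R
  have hFi : Integrable F := by
    refine Continuous.integrable_of_hasCompactSupport (by fun_prop) ?_
    refine HasCompactSupport.intro (isCompact_Icc (a := -R) (b := R)) fun s hs => ?_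
    have : R ≤ |s| := by
      by_contra hlt
      exact hs (abs_le.1 (not_le.1 hlt).le)
    simp [hF, truncTail_of_le this]
  have h1 : ∫ s, F s = ∫ s : ℝ, ((Real.cos (w * |s|) * truncTail R |s| : ℝ) : ℂ) := by
    have h2 : (2 : ℂ) * ∫ s, F s = 2 * ∫ s : ℝ, ((Real.cos (w * |s|) * truncTail R |s| : ℝ) : ℂ) := by
      calc (2 : ℂ) * ∫ s, F s = (∫ s, F s) + ∫ s, F (-s) := by
            rw [integral_neg_eq_self F volume]; ring
        _ = ∫ s, (F s + F (-s)) := (integral_add hFi hFi.comp_neg).symm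
        _ = _ := by
            rw [← integral_const_mul]
            congr 1
            ext s
            have h3 : Real.cos (w * |s|) = Real.cos (w * s) := by
              rw [← Real.cos_abs (w * |s|), ← Real.cos_abs (w * s), abs_mul, abs_mul, abs_abs]
            rw [h3]
            simp only [hF, abs_neg]
            push_cast
            rw [← add_mul, ← mul_assoc]
            congr 1
            rw [Complex.two_cos]
            ring_nf
    exact mul_left_cancel₀ two_ne_zero h2
  rw [h1, integral_complex_ofReal]
  congr 1
  rw [integral_comp_abs (f := fun s => Real.cos (w * s) * truncTail R s)]
  congr 1
  rw [intervalIntegral.integral_of_le hR]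
  have h4 : ∫ s in Ioi (0 : ℝ), Real.cos (w * s) * truncTail R s =
      ∫ s in Ioc (0 : ℝ) R, Real.cos (w * s) * truncTail R s := by
    refine (setIntegral_eq_of_subset_of_forall_sdiff_eq_zero measurableSet_Ioi
      Ioc_subset_Ioi_self fun s hs => ?_)
    have : R ≤ s := by
      by_contra hlt
      exact hs.2 ⟨hs.1, (not_le.1 hlt).le⟩
    rw [truncTail_of_le this, mul_zero]
  rw [h4]
  refine setIntegral_congr_fun measurableSet_Ioc fun s hs => ?_
  simp only [truncTail_of_ge hs.2]

/-- The radial profile `truncSq R` as a function on `ℝ³`. -/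
noncomputable def radialSq (R : ℝ) (x : Fin 3 → ℝ) : ℂ :=
  (truncSq R ‖(WithLp.toLp 2 x : EuclideanSpace ℝ (Fin 3))‖ : ℂ)

lemma continuous_radialSq (R : ℝ) : Continuous (radialSq R) := by
  have := continuous_truncSq R
  unfold radialSq
  fun_prop

lemma hasCompactSupport_radialSq (R : ℝ) : HasCompactSupport (radialSq R) := by
  refine HasCompactSupport.intro (isCompact_closedBall (0 : Fin 3 → ℝ) |R|) fun x hx => ?_
  have h1 : |R| < ‖x‖ := by simpa using hx
  have h2 : ‖x‖ ≤ ‖(WithLp.toLp 2 x : EuclideanSpace ℝ (Fin 3))‖ :=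
    (pi_norm_le_iff_of_nonneg (norm_nonneg _)).2 fun i =>
      PiLp.norm_apply_le (WithLp.toLp 2 x : EuclideanSpace ℝ (Fin 3)) i
  rw [radialSq, truncSq_of_le ((le_abs_self R).trans (h1.le.trans h2)), Complex.ofReal_zero]

/-- Rotation invariance: the Fourier integral of a radial function depends only on the length of
the frequency. -/
lemma integral_exp_inner_radial (g : ℝ → ℂ) (ξ : EuclideanSpace ℝ (Fin 3)) :
    ∫ y : EuclideanSpace ℝ (Fin 3), Complex.exp (-(inner ℝ ξ y : ℝ) * Complex.I) * g ‖y‖ =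
      ∫ y : EuclideanSpace ℝ (Fin 3), Complex.exp (-(‖ξ‖ * y 0 : ℝ) * Complex.I) * g ‖y‖ := by
  set η : EuclideanSpace ℝ (Fin 3) := EuclideanSpace.single 0 ‖ξ‖ with hη
  have hn : ‖ξ‖ = ‖η‖ := by simp [hη]
  -- the reflection exchanging `ξ` and the vector of the same length on the first axis
  set L := (Submodule.span ℝ {ξ - η})ᗮ.reflection with hL
  have hLξ : L ξ = η := Submodule.reflection_sub hn
  rw [← L.measurePreserving.integral_comp L.toHomeomorph.measurableEmbedding
    (fun y => Complex.exp (-(‖ξ‖ * y 0 : ℝ) * Complex.I) * g ‖y‖)]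
  congr 1
  ext y
  have h : (inner ℝ ξ y : ℝ) = ‖ξ‖ * L y 0 := by
    rw [← L.inner_map_map, hLξ, hη, EuclideanSpace.inner_single_left]
    simp
  rw [h, L.norm_map]

lemma integral_exp_radialSq {R : ℝ} (hR : 0 ≤ R) (w : ℝ) :
    ∫ x : Fin 3 → ℝ, Complex.exp (-(w * x 0 : ℝ) * Complex.I) * radialSq R x =
      ((4 * Real.pi * ∫ s in (0 : ℝ)..R,
        Real.cos (w * s) * (R * (R - s) ^ 3 / 6 - (R - s) ^ 4 / 8) : ℝ) : ℂ) := by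
  have hc := continuous_radialSq R
  have hint : Integrable fun x : Fin 3 → ℝ =>
      Complex.exp (-(w * x 0 : ℝ) * Complex.I) * radialSq R x :=
    Continuous.integrable_of_hasCompactSupport (by fun_prop) (hasCompactSupport_radialSq R).mul_left
  have hmp := (volume_preserving_piFinSuccAbove (fun _ : Fin 3 => ℝ) 0).symm
  have hint' := (hmp.integrable_comp_emb (MeasurableEquiv.measurableEmbedding _)).2 hint
  rw [Function.comp_def] at hint'
  rw [← hmp.integral_comp', Measure.volume_eq_prod, integral_prod _ hint']
  have hin : ∀ s : ℝ, ∫ z : Fin 2 → ℝ, radialSq R (Fin.insertNth 0 s z) =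
      ((2 * Real.pi * truncTail R |s| : ℝ) : ℂ) := by
    intro s
    rw [← integral_slice, ← integral_complex_ofReal,
      ← (PiLp.volume_preserving_toLp (Fin 2)).integral_comp
        (MeasurableEquiv.toLp 2 (Fin 2 → ℝ)).measurableEmbedding]
    congr 1
    ext z
    rw [radialSq]
    congr 2
    rw [EuclideanSpace.norm_eq, EuclideanSpace.norm_sq_eq]
    simp [Fin.sum_univ_succ]
  have hstep : ∀ s : ℝ, ∫ z : Fin 2 → ℝ,
      (fun x : Fin 3 → ℝ => Complex.exp (-(w * x 0 : ℝ) * Complex.I) * radialSq R x)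
        ((MeasurableEquiv.piFinSuccAbove (fun _ : Fin 3 => ℝ) 0).symm (s, z)) =
      (2 * Real.pi : ℝ) * (Complex.exp (-(w * s : ℝ) * Complex.I) * (truncTail R |s| : ℂ)) := by
    intro s
    have : ∀ z : Fin 2 → ℝ, (MeasurableEquiv.piFinSuccAbove (fun _ : Fin 3 => ℝ) 0).symm (s, z) =
      Fin.insertNth 0 s z := fun z => rfl
    simp only [this, Fin.insertNth_apply_same]
    rw [integral_const_mul, hin]
    push_cast
    ring
  calc _ = ∫ s : ℝ, (2 * Real.pi : ℝ) *
        (Complex.exp (-(w * s : ℝ) * Complex.I) * (truncTail R |s| : ℂ)) := by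
        congr 1
        ext s
        exact hstep s
    _ = _ := by
        rw [integral_const_mul, integral_exp_truncTail hR]
        push_cast
        ring

/-- The Fourier transform of `radialSq R` at a lattice point, reduced to a cosine integral. -/
lemma fourier_radialSq {R : ℝ} (hR : 0 ≤ R) (m : Fin 3 → ℤ) :
    ∫ x : Fin 3 → ℝ, UnitAddTorus.mFourier (-m) (toTorus x) * radialSq R x =
      ((4 * Real.pi * ∫ s in (0 : ℝ)..R, Real.cos (2 * Real.pi * √(sqLen m) * s) *
        (R * (R - s) ^ 3 / 6 - (R - s) ^ 4 / 8) : ℝ) : ℂ) := by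
  set ξ : EuclideanSpace ℝ (Fin 3) := (2 * Real.pi) • WithLp.toLp 2 (fun i => (m i : ℝ)) with hξ
  have hξn : ‖ξ‖ = 2 * Real.pi * √(sqLen m) := by
    rw [hξ, norm_smul, norm_lattice, Real.norm_of_nonneg (by positivity)]
  have h1 : ∀ x : Fin 3 → ℝ, UnitAddTorus.mFourier (-m) (toTorus x) =
      Complex.exp (-(inner ℝ ξ (WithLp.toLp 2 x) : ℝ) * Complex.I) := by
    intro x
    simp only [UnitAddTorus.mFourier, toTorus, ContinuousMap.coe_mk, Pi.neg_apply,
      fourier_coe_apply, ← Complex.exp_sum, hξ]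
    congr 1
    rw [real_inner_smul_left, PiLp.inner_apply]
    simp [Fin.sum_univ_three]
    ring
  have h2 := integral_exp_inner_radial (fun r => (truncSq R r : ℂ)) ξ
  rw [← (PiLp.volume_preserving_toLp (Fin 3)).integral_comp
      (MeasurableEquiv.toLp 2 (Fin 3 → ℝ)).measurableEmbedding,
    ← (PiLp.volume_preserving_toLp (Fin 3)).integral_comp
      (MeasurableEquiv.toLp 2 (Fin 3 → ℝ)).measurableEmbedding] at h2
  simp_rw [h1]
  refine h2.trans ?_
  rw [hξn]
  exact integral_exp_radialSq hR _

/-! ### Iterated integrals of the counting function -/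

/-- The lattice points in the closed ball of radius `R`. -/
noncomputable def ballPts (R : ℝ) : Finset (Fin 3 → ℤ) :=
  ((Finset.finite_toSet _).subset (ball_subset R)).toFinset

lemma mem_ballPts {R : ℝ} {a : Fin 3 → ℤ} : a ∈ ballPts R ↔ √(sqLen a) ≤ R := by
  rw [ballPts, Set.Finite.mem_toFinset, mem_ofPred_eq, norm_lattice]

lemma N3_eq_sum {R σ : ℝ} (h : σ ≤ R) :
    N3 σ = ∑ a ∈ ballPts R, if √(sqLen a) ≤ σ then (1 : ℝ) else 0 := by
  rw [Finset.sum_boole, N3, ← Set.ncard_coe_finset]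
  congr 2
  ext a
  simp only [mem_ofPred_eq, norm_lattice, Finset.coe_filter, mem_ballPts]
  exact ⟨fun h' => ⟨h'.trans h, h'⟩, fun h' => h'.2⟩

/-- The counting function is right continuous, since the balls are closed. -/
lemma continuousWithinAt_N3 (x : ℝ) : ContinuousWithinAt N3 (Ioi x) x := by
  have hev : ∀ᶠ y in nhdsWithin x (Ioi x), N3 y =
      ∑ a ∈ ballPts (x + 1), if √(sqLen a) ≤ y then (1 : ℝ) else 0 := by
    filter_upwards [nhdsWithin_le_nhds (Iic_mem_nhds (lt_add_one x))] with y hy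
    exact N3_eq_sum hy
  refine ContinuousWithinAt.congr_of_eventuallyEq ?_ hev (N3_eq_sum (lt_add_one x).le)
  refine tendsto_finsetSum _ fun a _ => ?_
  refine tendsto_const_nhds.congr' ?_
  rcases le_or_gt (√(sqLen a)) x with h | h
  · filter_upwards [self_mem_nhdsWithin] with y hy
    rw [if_pos h, if_pos (h.trans (le_of_lt hy))]
  · filter_upwards [nhdsWithin_le_nhds (Iio_mem_nhds h)] with y hy
    rw [if_neg (not_le.2 h), if_neg (not_le.2 hy)]

lemma integral_step {ρ R : ℝ} (hρ : 0 ≤ ρ) (hR : 0 ≤ R) :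
    ∫ t in (0 : ℝ)..R, (if ρ ≤ t then (1 : ℝ) else 0) = max (R - ρ) 0 := by
  rw [intervalIntegral.integral_of_le hR, integral_Ioc_eq_integral_Ioo,
    ← integral_Icc_eq_integral_Ioo]
  have h : (fun t : ℝ => if ρ ≤ t then (1 : ℝ) else 0) = (Ici ρ).indicator fun _ => 1 := by
    ext t
    simp [indicator_apply]
  rw [h, setIntegral_indicator measurableSet_Ici]
  have : Icc 0 R ∩ Ici ρ = Icc ρ R := by
    ext t
    simp only [mem_inter_iff, mem_Icc, mem_Ici]
    constructor
    · rintro ⟨⟨_, h2⟩, h3⟩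
      exact ⟨h3, h2⟩
    · rintro ⟨h1, h2⟩
      exact ⟨⟨hρ.trans h1, h2⟩, h1⟩
  rw [this]
  simp [measureReal_def, ENNReal.toReal_ofReal']

lemma integral_truncLin {ρ : ℝ} (hρ : 0 ≤ ρ) (R : ℝ) :
    ∫ t in (0 : ℝ)..R, max (t - ρ) 0 = truncSq R ρ := by
  have hd : ∀ t : ℝ, HasDerivAt (fun t => max (t - ρ) 0 ^ 2 / 2) (max (t - ρ) 0) t := by
    intro t
    have h1 := (hasDerivAt_posPart_pow 0 (t - ρ)).comp t ((hasDerivAt_id t).sub_const ρ)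
    refine (h1.div_const 2).congr_deriv ?_
    simp
  rw [intervalIntegral.integral_eq_sub_of_hasDerivAt (fun s _ => hd s)
    (Continuous.intervalIntegrable (by fun_prop) _ _), truncSq]
  simp [hρ]

lemma N3k_one_eq_sum {R σ : ℝ} (h0 : 0 ≤ σ) (h : σ ≤ R) :
    N3k 1 σ = ∑ a ∈ ballPts R, max (σ - √(sqLen a)) 0 := by
  change ∫ t in (0 : ℝ)..σ, N3 t = _
  rw [intervalIntegral.integral_congr (g := fun t => ∑ a ∈ ballPts R,
    if √(sqLen a) ≤ t then (1 : ℝ) else 0)]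
  · rw [intervalIntegral.integral_finsetSum]
    · exact Finset.sum_congr rfl fun a _ => integral_step (Real.sqrt_nonneg _) h0
    · intro a _
      apply Monotone.intervalIntegrable
      intro s t hst
      dsimp only
      split_ifs with h1 h2
      · exact le_rfl
      · exact absurd (h1.trans hst) h2
      · exact zero_le_one
      · exact le_rfl
  · intro t ht
    rw [uIcc_of_le h0] at ht
    exact N3_eq_sum (ht.2.trans h)

lemma N3k_two_eq_sum {R : ℝ} (hR : 0 ≤ R) :
    N3k 2 R = ∑ a ∈ ballPts R, truncSq R √(sqLen a) := by
  change ∫ t in (0 : ℝ)..R, N3k 1 t = _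
  rw [intervalIntegral.integral_congr (g := fun t => ∑ a ∈ ballPts R, max (t - √(sqLen a)) 0)]
  · rw [intervalIntegral.integral_finsetSum]
    · exact Finset.sum_congr rfl fun a _ => integral_truncLin (Real.sqrt_nonneg _) R
    · exact fun a _ => Continuous.intervalIntegrable (by fun_prop) _ _
  · intro t ht
    rw [uIcc_of_le hR] at ht
    exact N3k_one_eq_sum ht.1 ht.2

lemma finsum_radialSq {R : ℝ} (hR : 0 ≤ R) :
    ∑ᶠ a : Fin 3 → ℤ, radialSq R (latticePt a) = (N3k 2 R : ℂ) := by
  have h : ∀ a : Fin 3 → ℤ, radialSq R (latticePt a) = (truncSq R √(sqLen a) : ℂ) := fun a => by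
    rw [radialSq, ← norm_lattice]
    rfl
  simp_rw [h]
  rw [finsum_eq_sum_of_support_subset (s := ballPts R), N3k_two_eq_sum hR, Complex.ofReal_sum]
  intro a ha
  by_contra hne
  rw [Finset.mem_coe, mem_ballPts, not_le] at hne
  exact ha (by simp [truncSq_of_le hne.le])

lemma continuous_N3k_succ (k : ℕ) : Continuous (N3k (k + 1)) :=
  intervalIntegral.continuous_primitive (N3k_aux k).1 0

lemma N3k_succ_zero (k : ℕ) : N3k (k + 1) 0 = 0 := by
  simp [N3k]

lemma hasDerivWithinAt_N3k_succ (k : ℕ) (x : ℝ) :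
    HasDerivWithinAt (N3k (k + 1)) (N3k k x) (Ioi x) x := by
  have hc : ContinuousWithinAt (N3k k) (Ioi x) x := by
    cases k with
    | zero => exact continuousWithinAt_N3 x
    | succ k => exact (continuous_N3k_succ k).continuousWithinAt
  have h := intervalIntegral.integral_hasDerivWithinAt_right (s := Ici x) (t := Ioi x)
    ((N3k_aux k).1 0 x)
    ((N3k_aux k).2.1.stronglyMeasurableAtFilter) hc
  exact h.mono Ioi_subset_Ici_self

/-! ### The terms of the oscillatory series and the constants -/

lemma sqrt_pnat_pos (n : ℕ+) : 0 < √(n : ℝ) := Real.sqrt_pos.2 (by exact_mod_cast n.pos)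

lemma I_pow_succ_re (k : ℕ) : (Complex.I ^ (k + 1)).re = -(Complex.I ^ k).im := by
  simp [pow_succ]

lemma I_pow_succ_im (k : ℕ) : (Complex.I ^ (k + 1)).im = (Complex.I ^ k).re := by
  simp [pow_succ]

lemma abs_I_pow_re_le (k : ℕ) : |(Complex.I ^ k).re| ≤ 1 := by
  simpa using Complex.abs_re_le_norm (Complex.I ^ k)

lemma abs_I_pow_im_le (k : ℕ) : |(Complex.I ^ k).im| ≤ 1 := by
  simpa using Complex.abs_im_le_norm (Complex.I ^ k)

lemma continuous_oscTerm (k : ℕ) (n : ℕ+) : Continuous (oscTerm k n) := by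
  unfold oscTerm; fun_prop

lemma hasDerivAt_oscTerm_succ (k : ℕ) (n : ℕ+) (x : ℝ) :
    HasDerivAt (oscTerm (k + 1) n) (oscTerm k n x) x := by
  unfold oscTerm
  simp only [I_pow_succ_re, I_pow_succ_im]
  have hw : 2 * Real.pi * √(n : ℝ) ≠ 0 :=
    (mul_pos (by positivity) (sqrt_pnat_pos n)).ne'
  generalize 2 * Real.pi * √(n : ℝ) = w at *
  have hl : HasDerivAt (fun s : ℝ => w * s) w x := by
    simpa using (hasDerivAt_id x).const_mul w
  have hs := hl.sin
  have hc := hl.cos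
  have hi := hasDerivAt_id x
  refine (((((hi.mul hc).const_mul _).add ((hi.mul hs).const_mul _)).add
    (hc.const_mul _)).sub (hs.const_mul _) |>.const_mul _).congr_deriv ?_
  simp only [id]
  push_cast
  field_simp
  ring

lemma one_le_freq (n : ℕ+) : 1 ≤ 2 * Real.pi * √(n : ℝ) := by
  have h1 : 1 ≤ √(n : ℝ) := Real.one_le_sqrt.2 (by exact_mod_cast one_le)
  nlinarith [Real.pi_gt_three]

lemma freq_sq (n : ℕ+) : (2 * Real.pi * √(n : ℝ)) ^ 2 = 4 * Real.pi ^ 2 * n := by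
  rw [mul_pow, Real.sq_sqrt (Nat.cast_nonneg _)]
  ring

lemma one_div_freq_pow_le {k : ℕ} (hk : 2 ≤ k) (n : ℕ+) :
    1 / (2 * Real.pi * √(n : ℝ)) ^ k ≤ 1 / (n : ℝ) := by
  have hn : (0 : ℝ) < n := by exact_mod_cast n.pos
  refine one_div_le_one_div_of_le hn ?_
  calc (n : ℝ) ≤ (2 * Real.pi * √(n : ℝ)) ^ 2 := by
        rw [freq_sq]
        have : 1 ≤ 4 * Real.pi ^ 2 := by nlinarith [Real.pi_gt_three]
        exact le_mul_of_one_le_left hn.le this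
    _ ≤ _ := pow_le_pow_right₀ (one_le_freq n) hk

/-- For `k ≥ 2` the oscillatory series is dominated by a convergent series, locally uniformly. -/
lemma abs_oscTerm_le {k : ℕ} (hk : 2 ≤ k) (n : ℕ+) (x : ℝ) :
    |oscTerm k n x| ≤ (r3 n * ((n : ℝ) ^ 2)⁻¹) * (2 * |x| + 2 * (k + 1)) := by
  have hn : (0 : ℝ) < n := by exact_mod_cast n.pos
  have hk1 := one_div_freq_pow_le hk n
  have hw := one_le_freq n
  have hpi : 1 / Real.pi ≤ 1 := by
    rw [div_le_one Real.pi_pos]; linarith [Real.pi_gt_three]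
  have hre := abs_I_pow_re_le k
  have him := abs_I_pow_im_le k
  unfold oscTerm
  generalize (Complex.I ^ k).re = b at *
  generalize (Complex.I ^ k).im = c at *
  generalize 2 * Real.pi * √(n : ℝ) = w at *
  have hw0 : 0 < w := by linarith
  have hcos := Real.abs_cos_le_one (w * x)
  have hsin := Real.abs_sin_le_one (w * x)
  have hq0 : 0 ≤ ((k : ℝ) + 1) / w := by positivity
  have hq : ((k : ℝ) + 1) / w ≤ k + 1 := div_le_self (by positivity) hw
  have e1 : |b * (x * Real.cos (w * x))| ≤ |x| := by
    rw [abs_mul, abs_mul]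
    calc _ ≤ 1 * (|x| * 1) := by gcongr
      _ = |x| := by ring
  have e2 : |c * (x * Real.sin (w * x))| ≤ |x| := by
    rw [abs_mul, abs_mul]
    calc _ ≤ 1 * (|x| * 1) := by gcongr
      _ = |x| := by ring
  have e3 : |((k : ℝ) + 1) / w * c * Real.cos (w * x)| ≤ k + 1 := by
    rw [abs_mul, abs_mul, abs_of_nonneg hq0]
    calc _ ≤ ((k : ℝ) + 1) * 1 * 1 := by gcongr
      _ = k + 1 := by ring
  have e4 : |((k : ℝ) + 1) / w * b * Real.sin (w * x)| ≤ k + 1 := by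
    rw [abs_mul, abs_mul, abs_of_nonneg hq0]
    calc _ ≤ ((k : ℝ) + 1) * 1 * 1 := by gcongr
      _ = k + 1 := by ring
  have hA : |-(1 / Real.pi) * ((r3 n : ℝ) / n) * (1 / w ^ k)| ≤ r3 n * ((n : ℝ) ^ 2)⁻¹ := by
    rw [abs_mul, abs_mul, abs_neg, abs_of_nonneg (by positivity : 0 ≤ 1 / Real.pi),
      abs_of_nonneg (by positivity : 0 ≤ (r3 n : ℝ) / n),
      abs_of_nonneg (by positivity : 0 ≤ 1 / w ^ k)]
    calc _ ≤ 1 * ((r3 n : ℝ) / n) * (1 / n) := by gcongr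
      _ = _ := by field_simp
  rw [abs_mul]
  gcongr
  refine (abs_sub _ _).trans ?_
  have t1 := abs_add_le (b * (x * Real.cos (w * x)) + c * (x * Real.sin (w * x)))
    (((k : ℝ) + 1) / w * c * Real.cos (w * x))
  have t2 := abs_add_le (b * (x * Real.cos (w * x))) (c * (x * Real.sin (w * x)))
  linarith

lemma summable_oscTerm_bound (k : ℕ) (B : ℝ) :
    Summable fun n : ℕ+ => (r3 n * ((n : ℝ) ^ 2)⁻¹) * (2 * B + 2 * (k + 1)) :=
  summable_r3.mul_right _

lemma summable_abs_oscTerm {k : ℕ} (hk : 2 ≤ k) (x : ℝ) :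
    Summable fun n : ℕ+ => |oscTerm k n x| :=
  Summable.of_nonneg_of_le (fun _ => abs_nonneg _) (fun n => abs_oscTerm_le hk n x)
    (summable_oscTerm_bound k |x|)

lemma summable_oscTerm {k : ℕ} (hk : 2 ≤ k) (x : ℝ) : Summable fun n : ℕ+ => oscTerm k n x :=
  (summable_abs_oscTerm hk x).of_abs

lemma summable_r3_const (j : ℕ) :
    Summable fun n : ℕ+ => (r3 n : ℝ) * (n : ℝ) ^ (-2 - (j : ℝ) / 2) :=
  summable_r3_rpow (by have : (0 : ℝ) ≤ j := Nat.cast_nonneg j; linarith)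

lemma I_pow_re_eq (k : ℕ) :
    (Complex.I ^ k).re = if k % 2 = 1 then 0 else if k % 4 = 0 then 1 else -1 := by
  have h : Complex.I ^ k = Complex.I ^ (k % 4) := by
    conv_lhs => rw [← Nat.mod_add_div k 4, pow_add, pow_mul, Complex.I_pow_four, one_pow, mul_one]
  rw [h]
  have h4 : k % 4 < 4 := Nat.mod_lt _ (by norm_num)
  have h2 : k % 2 = k % 4 % 2 := by omega
  rw [h2]
  interval_cases k % 4 <;> simp [pow_succ]

lemma C_eq (k : ℕ) : C k = (Complex.I ^ k).re * ((2 * (k : ℝ) + 4) *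
    ((2 * Real.pi) ^ (k + 3))⁻¹ * ∑' n : ℕ+, (r3 n : ℝ) * (n : ℝ) ^ (-2 - (k : ℝ) / 2)) := by
  rw [I_pow_re_eq, C]
  split_ifs <;> ring

/-- The values at the origin of the oscillatory terms add up to the constants of integration. -/
lemma hasSum_oscTerm_succ_zero (k : ℕ) :
    HasSum (fun n : ℕ+ => oscTerm (k + 1) n 0) (-C k) := by
  have h := (summable_r3_const k).hasSum.mul_left
    (-((Complex.I ^ k).re * ((2 * (k : ℝ) + 4) * ((2 * Real.pi) ^ (k + 3))⁻¹)))
  have hC : -C k = -((Complex.I ^ k).re * ((2 * (k : ℝ) + 4) * ((2 * Real.pi) ^ (k + 3))⁻¹)) *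
      ∑' n : ℕ+, (r3 n : ℝ) * (n : ℝ) ^ (-2 - (k : ℝ) / 2) := by
    rw [C_eq]; ring
  rw [hC]
  refine h.congr_fun fun n => ?_
  have hs := sqrt_pnat_pos n
  have hn : (0 : ℝ) < n := by exact_mod_cast n.pos
  have hp : (n : ℝ) ^ (-2 - (k : ℝ) / 2) = ((n : ℝ) * √(n : ℝ) ^ (k + 2))⁻¹ := by
    rw [Real.sqrt_eq_rpow, ← Real.rpow_natCast, ← Real.rpow_mul hn.le]
    nth_rewrite 2 [← Real.rpow_one (n : ℝ)]
    rw [← Real.rpow_add hn, ← Real.rpow_neg hn.le]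
    congr 1
    push_cast
    ring
  rw [hp]
  unfold oscTerm
  rw [I_pow_succ_im]
  have hpi := Real.pi_pos.ne'
  simp only [mul_zero, Real.cos_zero, Real.sin_zero, zero_add, sub_zero, mul_one]
  push_cast
  field_simp
  ring

lemma hasDerivAt_polyPart_succ (k : ℕ) (x : ℝ) :
    HasDerivAt (polyPart (k + 1)) (polyPart k x) x := by
  have h1 := (hasDerivAt_pow (3 + (k + 1)) x).const_mul
    (8 * Real.pi / ((3 + (k + 1)).factorial : ℝ))
  have h2 : HasDerivAt (fun x : ℝ => ∑ m ∈ Finset.range (k + 1),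
      C (k + 1 - 1 - m) / (m.factorial : ℝ) * x ^ m) (∑ m ∈ Finset.range (k + 1),
      C (k + 1 - 1 - m) / (m.factorial : ℝ) * ((m : ℝ) * x ^ (m - 1))) x :=
    HasDerivAt.fun_sum fun m _ => (hasDerivAt_pow m x).const_mul _
  refine (h1.add h2).congr_deriv ?_
  rw [Finset.sum_range_succ', polyPart]
  simp only [Nat.cast_zero, zero_mul, mul_zero, add_zero]
  congr 1
  · rw [show 3 + (k + 1) = (3 + k) + 1 by ring, Nat.factorial_succ]
    have := Nat.factorial_ne_zero (3 + k)
    rw [Nat.add_sub_cancel]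
    push_cast
    field_simp
  · refine Finset.sum_congr rfl fun m _ => ?_
    rw [show k + 1 - 1 - (m + 1) = k - 1 - m by omega, Nat.factorial_succ]
    have := Nat.factorial_ne_zero m
    rw [Nat.add_sub_cancel]
    push_cast
    field_simp

lemma continuous_polyPart (k : ℕ) : Continuous (polyPart k) := by
  unfold polyPart; fun_prop

lemma polyPart_succ_zero (k : ℕ) : polyPart (k + 1) 0 = C k := by
  rw [polyPart, Finset.sum_range_succ']
  simp

/-! ### The pointwise formula -/

/-- The Fourier transform of `radialSq R` as a function of the squared length of the frequency. -/
noncomputable def radialSqFourier (R : ℝ) (n : ℕ) : ℝ :=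
  4 * Real.pi * ∫ s in (0 : ℝ)..R, Real.cos (2 * Real.pi * √(n : ℝ) * s) *
        (R * (R - s) ^ 3 / 6 - (R - s) ^ 4 / 8)

lemma radialSqFourier_zero (R : ℝ) : radialSqFourier R 0 = Real.pi * R ^ 5 / 15 := by
  simp only [radialSqFourier, Nat.cast_zero, Real.sqrt_zero, mul_zero, zero_mul, Real.cos_zero,
    one_mul, integral_truncTail_zero]
  ring

/-- The Fourier transform of `radialSq R` on a shell, summed over the shell. It is the second
primitive of `oscTerm 0 n` vanishing to second order at `0`, which differs from `oscTerm 2 n` by a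
multiple of `R`. -/
lemma radialSqFourier_pnat (R : ℝ) (n : ℕ+) :
    r3 n * radialSqFourier R n = oscTerm 2 n R - R * oscTerm 1 n 0 := by
  have hs := sqrt_pnat_pos n
  have hn : (0 : ℝ) < n := by exact_mod_cast n.pos
  have hsq : √(n : ℝ) ^ 2 = n := Real.sq_sqrt hn.le
  rw [radialSqFourier, integral_cos_truncTail (by positivity), oscTerm, oscTerm]
  have hpi := Real.pi_pos.ne'
  simp only [Complex.I_sq, pow_one, Complex.neg_re, Complex.one_re, Complex.neg_im,
    Complex.one_im, Complex.I_re, Complex.I_im, mul_zero, Real.cos_zero, Real.sin_zero]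
  generalize Real.cos (2 * Real.pi * √(n : ℝ) * R) = c
  generalize Real.sin (2 * Real.pi * √(n : ℝ) * R) = d
  generalize √(n : ℝ) = s at *
  generalize (r3 n : ℝ) = r
  generalize ((n : ℕ) : ℝ) = y at *
  subst hsq
  push_cast
  field_simp
  ring

lemma C_one : C 1 = 0 := by simp [C]

lemma polyPart_two (R : ℝ) : polyPart 2 R = Real.pi * R ^ 5 / 15 + C 0 * R := by
  simp only [polyPart, Finset.sum_range_succ, Finset.sum_range_zero]
  simp [C_one, Nat.factorial]
  ring

lemma summable_radialSqFourier (R : ℝ) :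
    Summable fun a : Fin 3 → ℤ => radialSqFourier R (sqLen a) := by
  have hb : ∀ n : ℕ+, |radialSqFourier R n| ≤ 12 * Real.pi * (|R| + 1) * ((n : ℝ) ^ 2)⁻¹ := by
    intro n
    have hn : (0 : ℝ) < n := by exact_mod_cast n.pos
    have hw := one_le_freq n
    have hnw : (n : ℝ) ^ 2 ≤ (2 * Real.pi * √(n : ℝ)) ^ 4 := by
      have h := one_div_freq_pow_le le_rfl n
      rw [one_div_le_one_div (by positivity) hn] at h
      calc (n : ℝ) ^ 2 ≤ ((2 * Real.pi * √(n : ℝ)) ^ 2) ^ 2 := pow_le_pow_left₀ hn.le h 2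
        _ = _ := by ring
    rw [radialSqFourier, integral_cos_truncTail (by positivity)]
    generalize 2 * Real.pi * √(n : ℝ) = w at *
    have hw0 : 0 < w := by linarith
    have hcos := Real.abs_cos_le_one (w * R)
    have hsin := Real.abs_sin_le_one (w * R)
    have e : R * Real.cos (w * R) / w ^ 4 + 2 * R / w ^ 4 - 3 * Real.sin (w * R) / w ^ 5 =
        (R * Real.cos (w * R) + 2 * R - 3 * (Real.sin (w * R) / w)) * (w ^ 4)⁻¹ := by
      field_simp
    have e1 : |R * Real.cos (w * R)| ≤ |R| := by
      rw [abs_mul]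
      exact mul_le_of_le_one_right (abs_nonneg _) hcos
    have e2 : |2 * R| = 2 * |R| := by rw [abs_mul, abs_two]
    have e3 : |3 * (Real.sin (w * R) / w)| ≤ 3 := by
      rw [abs_mul, abs_div, abs_of_pos hw0, abs_of_pos (by norm_num : (0 : ℝ) < 3)]
      have : |Real.sin (w * R)| / w ≤ 1 := (div_le_self (abs_nonneg _) hw).trans hsin
      linarith
    have t : |R * Real.cos (w * R) + 2 * R - 3 * (Real.sin (w * R) / w)| ≤ 3 * (|R| + 1) := by
      refine (abs_sub _ _).trans ?_
      have := abs_add_le (R * Real.cos (w * R)) (2 * R)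
      linarith
    have hpi := Real.pi_pos
    rw [e, abs_mul, abs_of_pos (by positivity : 0 < 4 * Real.pi), abs_mul,
      abs_of_pos (by positivity : 0 < (w ^ 4)⁻¹)]
    calc _ ≤ 4 * Real.pi * (3 * (|R| + 1) * ((n : ℝ) ^ 2)⁻¹) := by gcongr
      _ = _ := by ring
  refine Summable.of_norm_bounded_eventually (summable_sqLen.mul_left (12 * Real.pi * (|R| + 1))) ?_
  refine (Set.finite_singleton (0 : Fin 3 → ℤ)).subset fun a ha => ?_
  by_contra hne
  have hpos : 0 < sqLen a := Nat.pos_of_ne_zero fun h => hne (sqLen_eq_zero.1 h)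
  exact ha (hb ⟨sqLen a, hpos⟩)

/-- The case `k = 2`: Poisson summation for `radialSq R`, whose sum over `ℤ³` is `N3k 2 R`. -/
lemma N3k_two_eq {R : ℝ} (hR : 0 ≤ R) : N3k 2 R = polyPart 2 R + ∑' n : ℕ+, oscTerm 2 n R := by
  have hF : (fun m : Fin 3 → ℤ => ∫ x, UnitAddTorus.mFourier (-m) (toTorus x) * radialSq R x) =
      fun m => (radialSqFourier R (sqLen m) : ℂ) := funext fun m => fourier_radialSq hR m
  have hs := summable_radialSqFourier R
  have hp := hasSum_poisson (continuous_radialSq R) (hasCompactSupport_radialSq R)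
    (by rw [hF]; exact_mod_cast hs)
  rw [hF, finsum_radialSq hR] at hp
  have h1 : HasSum (fun m : Fin 3 → ℤ => radialSqFourier R (sqLen m)) (N3k 2 R) := by
    exact_mod_cast hp
  have h2 := hasSum_pnat (hasSum_shells h1)
  simp only [smul_eq_mul, radialSqFourier_pnat, r3_zero, radialSqFourier_zero, Nat.cast_one,
    one_mul] at h2
  have h3 := h2.add ((hasSum_oscTerm_succ_zero 0).mul_left R)
  simp only [zero_add, sub_add_cancel] at h3
  rw [h3.tsum_eq, polyPart_two]
  ring

lemma continuous_oscSum {k : ℕ} (hk : 2 ≤ k) : Continuous (oscSum k) := by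
  have h : ∀ B : ℝ, ContinuousOn (oscSum k) (Metric.ball 0 B) := fun B =>
    continuousOn_tsum (fun n => (continuous_oscTerm k n).continuousOn)
      (summable_oscTerm_bound k B) fun n x hx => by
        have hx' : |x| < B := by simpa using hx
        refine (abs_oscTerm_le hk n x).trans ?_
        gcongr
  rw [continuous_iff_continuousAt]
  intro x
  exact (h (|x| + 1)).continuousAt (Metric.isOpen_ball.mem_nhds (by simp))

lemma hasSum_integral_oscTerm {k : ℕ} (hk : 2 ≤ k) {x : ℝ} (hx : 0 ≤ x) :
    HasSum (fun n : ℕ+ => ∫ t in (0 : ℝ)..x, oscTerm k n t) (∫ t in (0 : ℝ)..x, oscSum k t) := by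
  refine intervalIntegral.hasSum_integral_of_dominated_convergence
    (fun n _ => (r3 n * ((n : ℝ) ^ 2)⁻¹) * (2 * x + 2 * (k + 1)))
    (fun n => (continuous_oscTerm k n).aestronglyMeasurable) (fun n => ?_)
    (Filter.Eventually.of_forall fun _ _ => summable_oscTerm_bound k x)
    intervalIntegrable_const
    (Filter.Eventually.of_forall fun t _ => (summable_oscTerm hk t).hasSum)
  refine Filter.Eventually.of_forall fun t ht => (abs_oscTerm_le hk n t).trans ?_
  rw [uIoc_of_le hx] at ht
  rw [abs_of_pos ht.1]
  have := ht.2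
  gcongr

/-- Integrating the formula for `k` from `0` gives the formula for `k + 1`: the constants of
integration are the `C k`. -/
theorem N3k_eq {k : ℕ} (hk : 2 ≤ k) : ∀ x : ℝ, 0 ≤ x →
    N3k k x = polyPart k x + ∑' n : ℕ+, oscTerm k n x := by
  induction k, hk using Nat.le_induction with
  | base => exact fun x hx => N3k_two_eq hx
  | succ k hk ih =>
    intro x hx
    change ∫ t in (0 : ℝ)..x, N3k k t = _
    have hc := continuous_oscSum hk
    rw [intervalIntegral.integral_congr (g := fun t => polyPart k t + oscSum k t)
      (fun t ht => ih t (by rw [uIcc_of_le hx] at ht; exact ht.1)),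
      intervalIntegral.integral_add ((continuous_polyPart k).intervalIntegrable _ _)
        (hc.intervalIntegrable _ _),
      intervalIntegral.integral_eq_sub_of_hasDerivAt
        (fun t _ => hasDerivAt_polyPart_succ k t)
        ((continuous_polyPart k).intervalIntegrable _ _), polyPart_succ_zero]
    have h1 : ∀ n : ℕ+, ∫ t in (0 : ℝ)..x, oscTerm k n t =
        oscTerm (k + 1) n x - oscTerm (k + 1) n 0 := fun n =>
      intervalIntegral.integral_eq_sub_of_hasDerivAt
        (fun t _ => hasDerivAt_oscTerm_succ k n t)
        ((continuous_oscTerm k n).intervalIntegrable _ _)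
    have h2 := hasSum_integral_oscTerm hk hx
    simp only [h1] at h2
    have h3 := h2.add (hasSum_oscTerm_succ_zero k)
    simp only [sub_add_cancel] at h3
    rw [h3.tsum_eq]
    ring

/-! ### The formula in the space of supported distributions -/

lemma isTemperedFun_oscSum {k : ℕ} (hk : 2 ≤ k) : IsTemperedFun (oscSum k) := by
  set S := ∑' n : ℕ+, (r3 n : ℝ) * ((n : ℝ) ^ 2)⁻¹ with hS
  have hS0 : 0 ≤ S := tsum_nonneg fun n => by positivity
  refine isTemperedFun_of_bound (continuous_oscSum hk).aestronglyMeasurable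
    (S * (2 + 2 * (k + 1))) 1 fun x hx => ?_
  have h1 : |oscSum k x| ≤ S * (2 * |x| + 2 * (k + 1)) :=
    tsum_of_norm_bounded (f := fun n => oscTerm k n x) (summable_r3.hasSum.mul_right _) fun n =>
       abs_oscTerm_le hk n x
  refine h1.trans ?_
  rw [mul_assoc, pow_one, abs_of_nonneg hx]
  refine mul_le_mul_of_nonneg_left ?_ hS0
  have hk0 : (0 : ℝ) ≤ k := Nat.cast_nonneg k
  nlinarith [sq_nonneg (x - 1), mul_nonneg hk0 (sq_nonneg x)]

lemma schwartz_integrable_linear (χ : 𝓢(ℝ, ℂ)) (B : ℝ) :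
    IntegrableOn (fun x => ‖χ x‖ * (2 * |x| + B)) (Ici 0) := by
  have hf : IsTemperedFun fun x => 2 * |x| + B := by
    refine isTemperedFun_of_bound (Continuous.aestronglyMeasurable (by fun_prop)) (2 + |B|) 1
      fun x hx => ?_
    refine (abs_add_le _ _).trans ?_
    rw [abs_mul, abs_abs, abs_of_nonneg hx, abs_two]
    nlinarith [sq_nonneg (x - 1), mul_nonneg (abs_nonneg B) (sq_nonneg x)]
  refine (integrableOn_mul hf χ).norm.mono' ?_ ?_
  · have := χ.continuous
    exact Continuous.aestronglyMeasurable (by fun_prop)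
  · refine Filter.Eventually.of_forall fun x => ?_
    rw [norm_mul, norm_mul, norm_norm, Complex.norm_real]

/-- For `k ≥ 2` the oscillatory series may be integrated termwise against a Schwartz function. -/
lemma hasSum_pairing_oscTerm {k : ℕ} (hk : 2 ≤ k) (χ : 𝓢(ℝ, ℂ)) :
    HasSum (fun n : ℕ+ => ∫ x in Ici (0 : ℝ), χ x * (oscTerm k n x : ℂ))
      (∫ x in Ici (0 : ℝ), χ x * (oscSum k x : ℂ)) := by
  have hb : ∀ x : ℝ, Summable fun n : ℕ+ =>
      (r3 n * ((n : ℝ) ^ 2)⁻¹) * (‖χ x‖ * (2 * |x| + 2 * (k + 1))) :=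
    fun x => summable_r3.mul_right _
  refine hasSum_integral_of_dominated_convergence
    (fun n x => (r3 n * ((n : ℝ) ^ 2)⁻¹) * (‖χ x‖ * (2 * |x| + 2 * (k + 1))))
    (fun n => (integrableOn_mul (isTemperedFun_oscTerm k n) χ).aestronglyMeasurable) (fun n => ?_)
    (Filter.Eventually.of_forall hb) ?_ (Filter.Eventually.of_forall fun x => ?_)
  · refine Filter.Eventually.of_forall fun x => ?_
    rw [norm_mul, Complex.norm_real, Real.norm_eq_abs]
    calc _ ≤ ‖χ x‖ * ((r3 n * ((n : ℝ) ^ 2)⁻¹) * (2 * |x| + 2 * (k + 1))) := by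
          gcongr
          exact abs_oscTerm_le hk n x
      _ = _ := by ring
  · simp_rw [tsum_mul_right]
    exact (schwartz_integrable_linear χ _).const_mul _
  · have h := (summable_oscTerm hk x).hasSum
    exact (Complex.hasSum_ofReal.2 h).mul_left (χ x)

/-- Integration by parts on the half line against a Schwartz function; a right derivative of `F`
is enough, which matters because the counting function jumps. -/
lemma pairing_eq_neg_pairing_deriv (χ : 𝓢(ℝ, ℂ)) {F f : ℝ → ℝ} (hF : IsTemperedFun F)
    (hf : IsTemperedFun f) (hc : Continuous F) (hfi : ∀ b, IntervalIntegrable f volume 0 b)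
    (hd : ∀ x, HasDerivWithinAt F (f x) (Ioi x) x) :
    ∫ x in Ici (0 : ℝ), χ x * (f x : ℂ) =
      -(χ 0 * (F 0 : ℂ)) - ∫ x in Ici (0 : ℝ), (SchwartzMap.derivCLM ℂ ℂ χ) x * (F x : ℂ) := by
  have hcF : Continuous fun x => (F x : ℂ) := by fun_prop
  have hχ := χ.continuous
  have hχ' := (SchwartzMap.derivCLM ℂ ℂ χ).continuous
  have hdχ : ∀ x, HasDerivAt χ (SchwartzMap.derivCLM ℂ ℂ χ x) x := fun x => by
    rw [SchwartzMap.derivCLM_apply]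
    exact χ.differentiableAt.hasDerivAt
  have hparts : ∀ b : ℝ, χ b * (F b : ℂ) = (∫ x in (0 : ℝ)..b, χ x * (f x : ℂ)) +
      χ 0 * (F 0 : ℂ) + ∫ x in (0 : ℝ)..b, (SchwartzMap.derivCLM ℂ ℂ χ) x * (F x : ℂ) := by
    intro b
    rw [intervalIntegral.integral_mul_deriv_eq_deriv_mul_of_hasDeriv_right
      (u := χ) (u' := SchwartzMap.derivCLM ℂ ℂ χ) (v := fun x => (F x : ℂ))
      hχ.continuousOn hcF.continuousOn
      (fun x _ => (hdχ x).hasDerivWithinAt) (fun x _ => (hd x).ofReal_comp)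
      (hχ'.intervalIntegrable _ _) ⟨(hfi b).1.ofReal, (hfi b).2.ofReal⟩]
    ring
  have i1 := (integrableOn_mul hf χ).mono_set Ioi_subset_Ici_self
  have i2 := (integrableOn_mul hF (SchwartzMap.derivCLM ℂ ℂ χ)).mono_set Ioi_subset_Ici_self
  have i3 := (integrableOn_mul hF χ).mono_set Ioi_subset_Ici_self
  have l1 := intervalIntegral_tendsto_integral_Ioi 0 i1 Filter.tendsto_id
  have l2 := intervalIntegral_tendsto_integral_Ioi 0 i2 Filter.tendsto_id
  have l3 := (l1.add_const (χ 0 * (F 0 : ℂ))).add l2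
  -- `χ * F` is integrable and has a limit at infinity, which is therefore zero
  have l4 : Filter.Tendsto (fun b => χ b * (F b : ℂ)) Filter.atTop _ :=
    l3.congr fun b => (hparts b).symm
  have hz := IntegrableAtFilter.eq_zero_of_tendsto
    (⟨Ioi 0, Filter.Ioi_mem_atTop 0, i3⟩ : IntegrableAtFilter _ Filter.atTop volume)
    (fun s hs => by
      obtain ⟨b, hb⟩ := Filter.mem_atTop_sets.1 hs
      -- a neighbourhood of infinity has infinite measure
      rw [← top_le_iff, ← Real.volume_Ici (a := b)]
      exact measure_mono hb) l4
  rw [integral_Ici_eq_integral_Ioi, integral_Ici_eq_integral_Ioi]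
  linear_combination hz

/-- The formula for `N3k k` tested against Schwartz functions: the pairings with the terms of the
oscillatory series are summable, with the expected sum. -/
def PairingFormula (k : ℕ) : Prop := ∀ χ : 𝓢(ℝ, ℂ),
  HasSum (fun n : ℕ+ => ∫ x in Ici (0 : ℝ), χ x * (oscTerm k n x : ℂ))
    ((∫ x in Ici (0 : ℝ), χ x * (N3k k x : ℂ)) - ∫ x in Ici (0 : ℝ), χ x * (polyPart k x : ℂ))

lemma pairingFormula_of_two_le {k : ℕ} (hk : 2 ≤ k) : PairingFormula k := by
  intro χ
  rw [← integral_sub (integrableOn_mul (isTemperedFun_N3k k) χ)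
    (integrableOn_mul (isTemperedFun_polyPart k) χ)]
  convert hasSum_pairing_oscTerm hk χ using 1
  refine setIntegral_congr_fun measurableSet_Ici fun x hx => ?_
  simp only [N3k_eq hk x hx, oscSum]
  push_cast
  ring

/-- Differentiating the formula, by testing the formula for `k + 1` against `-χ'`. The boundary
terms at the origin add up to the constant `C k`. -/
lemma PairingFormula.of_succ {k : ℕ} (h : PairingFormula (k + 1)) : PairingFormula k := by
  intro χ
  have h1 := ((hasSum_oscTerm_succ_zero k).mapL Complex.ofRealCLM).mul_left (χ 0)
  have h2 := (h1.add (h (SchwartzMap.derivCLM ℂ ℂ χ))).neg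
  rw [pairing_eq_neg_pairing_deriv χ (isTemperedFun_N3k (k + 1)) (isTemperedFun_N3k k)
      (continuous_N3k_succ k) (fun b => (N3k_aux k).1 0 b) (hasDerivWithinAt_N3k_succ k),
    pairing_eq_neg_pairing_deriv χ (isTemperedFun_polyPart (k + 1)) (isTemperedFun_polyPart k)
      (continuous_polyPart _) (fun b => (continuous_polyPart k).intervalIntegrable _ _)
      (fun x => (hasDerivAt_polyPart_succ k x).hasDerivWithinAt),
    N3k_succ_zero, polyPart_succ_zero]
  have hosc : ∀ n : ℕ+, ∫ x in Ici (0 : ℝ), χ x * (oscTerm k n x : ℂ) =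
      -(χ 0 * (oscTerm (k + 1) n 0 : ℂ) +
        ∫ x in Ici (0 : ℝ), (SchwartzMap.derivCLM ℂ ℂ χ) x * (oscTerm (k + 1) n x : ℂ)) := by
    intro n
    rw [pairing_eq_neg_pairing_deriv χ (isTemperedFun_oscTerm (k + 1) n)
      (isTemperedFun_oscTerm k n) (continuous_oscTerm _ n)
      (fun b => (continuous_oscTerm k n).intervalIntegrable _ _)
      (fun x => (hasDerivAt_oscTerm_succ k n x).hasDerivWithinAt)]
    ring
  simp only [Complex.ofRealCLM_apply] at h2
  simp only [hosc]
  convert h2 using 1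
  · rfl
  · push_cast
    ring

theorem pairingFormula : ∀ k, PairingFormula k
  | 0 => (pairingFormula_of_two_le le_rfl).of_succ.of_succ
  | 1 => (pairingFormula_of_two_le le_rfl).of_succ
  | k + 2 => pairingFormula_of_two_le (Nat.le_add_left 2 k)

/-- A sum in `SupportedDist` is tested by pairing, the topology being induced by the weak-* one. -/
lemma hasSum_supportedDist_iff {ι : Type*} {f : ι → SupportedDist} {u : SupportedDist} :
    HasSum f u ↔ ∀ χ : 𝓢(ℝ, ℂ), HasSum (fun i => (f i : 𝓢'(ℝ, ℂ)) χ) ((u : 𝓢'(ℝ, ℂ)) χ) := by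
  simp only [HasSum]
  rw [Topology.IsInducing.subtypeVal.tendsto_nhds_iff,
    PointwiseConvergenceCLM.tendsto_iff_forall_tendsto]
  refine forall_congr' fun χ => ?_
  refine Filter.tendsto_congr fun s => ?_
  simp

lemma hasSum_oscTermDist (k : ℕ) : HasSum (oscTermDist k) (N3kDist k - polyDist k) :=
  hasSum_supportedDist_iff.2 fun χ => pairingFormula k χ

/-- A continuous function on `[0, ∞)` is determined by its pairings with Schwartz functions. -/
lemma eqOn_of_ofFun_eq {f g : ℝ → ℝ} (hf : IsTemperedFun f) (hg : IsTemperedFun g)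
    (hfc : ContinuousOn f (Ici 0)) (hgc : ContinuousOn g (Ici 0))
    (h : ofFun f hf = ofFun g hg) : EqOn f g (Ici 0) := by
  have hsub : ContinuousOn (fun x => f x - g x) (Ici 0) := hfc.sub hgc
  have hae : ∀ᵐ x, x ∈ Ioi (0 : ℝ) → f x - g x = 0 := by
    refine isOpen_Ioi.ae_eq_zero_of_integral_contDiff_smul_eq_zero
      ((hsub.mono Ioi_subset_Ici_self).locallyIntegrableOn measurableSet_Ioi) ?_
    intro φ hφ hφc hφs
    have hcs : HasCompactSupport fun x => (φ x : ℂ) :=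
      hφc.comp_left (g := fun r : ℝ => (r : ℂ)) Complex.ofReal_zero
    let χ : 𝓢(ℝ, ℂ) := hcs.toSchwartzMap (Complex.ofRealCLM.contDiff.comp hφ)
    have hχ : ∀ x, χ x = (φ x : ℂ) := fun x => rfl
    have h1 : ∫ x in Ici (0 : ℝ), χ x * (f x : ℂ) = ∫ x in Ici (0 : ℝ), χ x * (g x : ℂ) := by
      rw [← ofFun_apply f hf χ, ← ofFun_apply g hg χ, h]
    rw [← sub_eq_zero, ← integral_sub (integrableOn_mul hf χ) (integrableOn_mul hg χ)] at h1
    have h2 : ∫ x in Ici (0 : ℝ), φ x • (f x - g x) = 0 := by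
      have h3 : ∫ x in Ici (0 : ℝ), ((φ x • (f x - g x) : ℝ) : ℂ) = 0 := by
        rw [← h1]
        congr 1
        ext x
        rw [hχ]
        push_cast [smul_eq_mul]
        ring
      rw [integral_complex_ofReal] at h3
      exact_mod_cast h3
    rw [← h2]
    refine (setIntegral_eq_integral_of_forall_compl_eq_zero fun x hx => ?_).symm
    rw [image_eq_zero_of_notMem_tsupport fun hx' => hx (Ioi_subset_Ici_self (hφs hx')), zero_smul]
  have hae' : (fun x => f x - g x) =ᵐ[volume.restrict (Ioi 0)] fun _ => 0 :=
    (ae_restrict_iff' measurableSet_Ioi).2 hae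
  have heq : EqOn (fun x => f x - g x) (fun _ => 0) (Ioi 0) :=
    Measure.eqOn_open_of_ae_eq hae' isOpen_Ioi (hsub.mono Ioi_subset_Ici_self)
      continuousOn_const
  have hcl : EqOn (fun x => f x - g x) (fun _ => 0) (Ici 0) :=
    heq.of_subset_closure hsub continuousOn_const Ioi_subset_Ici_self (by rw [closure_Ioi])
  exact fun x hx => sub_eq_zero.1 (hcl hx)

lemma oscDist_eq_ofFun {k : ℕ} (hk : 2 ≤ k) :
    oscDist k = ofFun (oscSum k) (isTemperedFun_oscSum hk) :=
  (hasSum_supportedDist_iff.2 fun χ => hasSum_pairing_oscTerm hk χ).tsum_eq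

lemma oscSum_zero {k : ℕ} (hk : 2 ≤ k) : oscSum k 0 = -C (k - 1) := by
  obtain ⟨j, rfl⟩ : ∃ j, k = j + 1 := ⟨k - 1, by omega⟩
  exact (hasSum_oscTerm_succ_zero j).tsum_eq

lemma hasSumUniformlyOn_oscTerm {k : ℕ} (hk : 2 ≤ k) {K : Set ℝ} (hK : IsCompact K) :
    HasSumUniformlyOn (oscTerm k) (oscSum k) K := by
  obtain ⟨B, hB⟩ := hK.isBounded.exists_norm_le
  refine HasSumUniformlyOn.of_norm_le_summable (summable_oscTerm_bound k B) fun n x hx => ?_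
  refine (abs_oscTerm_le hk n x).trans ?_
  have : |x| ≤ B := hB x hx
  gcongr

end GaussSphere

theorem theorem1 :
    -- the series defining the constants `C_j` converge absolutely
    (∀ j : ℕ, Summable fun n : ℕ+ => |(GaussSphere.r3 n : ℝ) * (n : ℝ) ^ (-2 - (j : ℝ) / 2)|) ∧
    ∀ k : ℕ,
      -- unconditional summability and the identity in the space of supported distributions
      Summable (GaussSphere.oscTermDist k) ∧
      GaussSphere.N3kDist k = GaussSphere.polyDist k + GaussSphere.oscDist k ∧
      (2 ≤ k →
        -- pointwise identity, with absolute convergence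
        (∀ x : ℝ, 0 ≤ x →
          Summable (fun n : ℕ+ => |GaussSphere.oscTerm k n x|) ∧
          GaussSphere.N3k k x = GaussSphere.polyPart k x + ∑' n : ℕ+, GaussSphere.oscTerm k n x) ∧
        -- the distribution `o_k` is given by a continuous function, the pointwise sum ...
        ContinuousOn (GaussSphere.oscSum k) (Set.Ici 0) ∧
        (∃ h : GaussSphere.IsTemperedFun (GaussSphere.oscSum k),
          GaussSphere.oscDist k = GaussSphere.ofFun (GaussSphere.oscSum k) h) ∧
        -- ... which is the only such continuous function
        (∀ (g : ℝ → ℝ) (hg : GaussSphere.IsTemperedFun g), ContinuousOn g (Set.Ici 0) →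
          GaussSphere.oscDist k = GaussSphere.ofFun g hg →
          Set.EqOn g (GaussSphere.oscSum k) (Set.Ici 0)) ∧
        -- value at the origin: the whole right-hand side vanishes there
        GaussSphere.polyPart k 0 + GaussSphere.oscSum k 0 = 0 ∧
        GaussSphere.oscSum k 0 = -GaussSphere.C (k - 1) ∧
        (Even k → GaussSphere.oscSum k 0 = 0) ∧
        -- uniform convergence on compact sets
        (∀ K : Set ℝ, IsCompact K → K ⊆ Set.Ici 0 →
          HasSumUniformlyOn (GaussSphere.oscTerm k) (GaussSphere.oscSum k) K)) := by
  open GaussSphere in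
  refine ⟨fun j => (summable_r3_const j).abs, fun k => ⟨(hasSum_oscTermDist k).summable, ?_,
    fun hk => ⟨fun x hx => ⟨summable_abs_oscTerm hk x, N3k_eq hk x hx⟩,
      (continuous_oscSum hk).continuousOn, ⟨isTemperedFun_oscSum hk, oscDist_eq_ofFun hk⟩,
      fun g hg hgc h => ?_, ?_, oscSum_zero hk, fun he => ?_,
      fun K hK _ => hasSumUniformlyOn_oscTerm hk hK⟩⟩⟩
  · rw [oscDist, (hasSum_oscTermDist k).tsum_eq, add_sub_cancel]
  · exact eqOn_of_ofFun_eq hg (isTemperedFun_oscSum hk) hgc (continuous_oscSum hk).continuousOn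
      (h.symm.trans (oscDist_eq_ofFun hk))
  · obtain ⟨j, rfl⟩ : ∃ j, k = j + 1 := ⟨k - 1, by omega⟩
    rw [polyPart_succ_zero, oscSum_zero hk, Nat.add_sub_cancel, add_neg_cancel]
  · obtain ⟨j, rfl⟩ := he
    rw [oscSum_zero hk, C, if_pos (by omega), neg_zero]
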